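/- Let $\theta\in(0,\pi)$. All functions are $\mathbb K$-valued with $\mathbb K\in\{\mathbb R,\mathbb C\}$. **Spaces.** For $M\in\{\Gamma,\mathbb R,\mathbb R_+\}$, with $\Gamma$ a planar cone as below equipped with its length measure, $\mathrm H^{1/2}(M)$ is the space of $\varphi\in \mathrm L^2(M)$ with $\|\varphi\|_{\mathrm H^{1/2}(M)}^2:=\|\varphi\|^2_{\mathrm L^2(M)}+\int_{M\times M}\frac{|\varphi(x)-\varphi(y)|^2}{|x-y|^2}\,dx\,dy<\infty$, and $\tilde{\mathrm H}^{1/2}(\mathbb R_+):=\{v\in \mathrm H^{1/2}(\mathbb R):\ v=0 \text{ on } (-\infty,0)\}$ carries the norm of $\mathrm H^{1/2}(\mathbb R)$. Put $\|v\|_{\mathrm H^{-1/2}(M)}:=\sup_{w\in \mathrm H^{1/2}(M)\setminus\{0\}}\frac{|\int_M v w|}{\|w\|_{\mathrm H^{1/2}(M)}}$ for $M=\Gamma,\mathbb R$ (curves without end points), and $\|q\|_{\mathrm H^{-1/2}(\mathbb R_+)}:=\sup_{w\in\tilde{\mathrm H}^{1/2}(\mathbb R_+)\setminus\{0\}}\frac{|\int_0^\infty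 q w|}{\|w\|_{\mathrm H^{1/2}(\mathbb R)}}$. Let $\mathscr C^\infty_{\rm comp}(\Gamma)$ be the set of restrictions to $\Gamma$ of smooth functions with bounded support in $\mathbb R^2$, $\mathscr C^\infty_{\rm comp}(\mathbb R)$ the set of smooth functions with bounded support in $\mathbb R$, and $\mathscr C^\infty_0(\mathbb R_+)$ the set of smooth functions with bounded support contained in $(0,\infty)$. **Operators on $\mathbb R_+$.** For $p,q\in\mathscr C_0^\infty(\mathbb R_+)$ and $\alpha\in(0,\pi)$ set $$\langle\mathscr A^\pm_\alpha p,q\rangle:=\int_0^\infty\!\!\int_0^\infty\big(\mathfrak K_0(t/s)\pm\mathfrak K_\alpha(t/s)\big)\,p(s)q(t)\,(st)^{-1/4}\,ds\,dt,\qquad \mathfrak K_\beta(\tau):=\big(4\sin^2\beta+(\sqrt\tau-1/\sqrt\tau)^2\big)^{-1/4}.$$ **Statement.** 1. $\mathscr A^+_{\pi/2}-\mathscr A^+_\theta=-\big(\mathscr A^-_{\pi/2}-\mathscr A^-_\theta\big)$, as operators from $\mathscr C_0^\infty(\mathbb R_+)$ to its dual. 2. There is a finite constant $C>0$, depending only on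 $\theta$, with the following property. Let $\mathbf c\in\mathbb R^2$, let $\mathbf e_\pm\in\mathbb R^2$ be unit vectors with $\mathbf e_+\cdot\mathbf e_-=\cos 2\theta$, let $\Gamma:=\{\mathbf c+t\mathbf e_+ : t\ge 0\}\cup\{\mathbf c+t\mathbf e_- : t\ge0\}$ be the cone of aperture $2\theta$, let $\chi_{\mathrm D}:\mathbb R^2\to\mathbb R$ be smooth, of bounded support and radially symmetric about $\mathbf c$, and put $\chi(t):=\chi_{\mathrm D}(\mathbf c+t\mathbf e_+)$ for $t\in\mathbb R$. Then $$C\,\|\mathscr A_\Gamma^\chi:\mathrm L^2(\Gamma)\to\mathrm H^{1/2}(\Gamma)\|\ \le\ \|\mathscr A_{\mathbb R}^\chi:\mathrm L^2(\mathbb R)\to\mathrm H^{1/2}(\mathbb R)\|+\sup_{p,q\in\mathscr C^\infty_0(\mathbb R_+)\setminus\{0\}}\frac{|\langle(\mathscr A^+_{\pi/2}-\mathscr A^+_\theta)\chi p,\chi q\rangle|}{\|p\|_{\mathrm L^2(\mathbb R_+)}\|q\|_{\mathrm H^{-1/2}(\mathbb R_+)}},$$ where for $(M,\psi)=(\Gamma,\chi_{\mathrm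 D})$ and $(M,\psi)=(\mathbb R,\chi)$ $$\|\mathscr A_M^\chi:\mathrm L^2(M)\to\mathrm H^{1/2}(M)\|:=\sup_{u,v\in\mathscr C^\infty_{\rm comp}(M)\setminus\{0\}}\frac{1}{\|u\|_{\mathrm L^2(M)}\|v\|_{\mathrm H^{-1/2}(M)}}\left|\int_{M}\int_M\frac{(\psi u)(y)\,(\psi v)(x)}{\sqrt{|x-y|}}\,dy\,dx\right|.$$ All suprema are taken in $[0,\infty]$. -/

import Mathlib

open MeasureTheory Set
open scoped ContDiff

namespace RieszCorner

/-- The Euclidean plane. -/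
abbrev Plane : Type := EuclideanSpace ℝ (Fin 2)

noncomputable section

/-! ### Function spaces over a measure

All spaces on a curve are described by the length measure `μ` carried by that curve: Lebesgue measure
on `ℝ`, its restriction to `(0, ∞)`, or the length measure on a cone in the plane. -/

section Spaces

variable {E 𝕜 : Type*} [NormedAddCommGroup E] [NormedSpace ℝ E] [MeasurableSpace E] [RCLike 𝕜]

/-- Smooth functions of bounded support on the ambient space; their restrictions to a subset `Γ`
form the space `C^∞_comp(Γ)`. -/
def SmoothComp (E 𝕜 : Type*) [NormedAddCommGroup E] [NormedSpace ℝ E] [RCLike 𝕜] : Set (E → 𝕜) :=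
  {u | ContDiff ℝ ∞ u ∧ HasCompactSupport u}

/-- `C^∞_0(ℝ₊)`: smooth functions with bounded support contained in `(0, ∞)`
(extended by zero to `ℝ`). -/
def SmoothComp₀ (𝕜 : Type*) [RCLike 𝕜] : Set (ℝ → 𝕜) :=
  {p | ContDiff ℝ ∞ p ∧ HasCompactSupport p ∧ tsupport p ⊆ Ioi 0}

/-- The squared Sobolev–Slobodeckii semi-norm
`∫∫ |φ(x) - φ(y)|² / |x - y|² dμ(y) dμ(x)` (the integrand is `0` on the diagonal). -/
def slobodeckijSq (μ : Measure E) (φ : E → 𝕜) : ENNReal :=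
  ∫⁻ x, ∫⁻ y, ‖φ x - φ y‖ₑ ^ 2 / ‖x - y‖ₑ ^ 2 ∂μ ∂μ

/-- The norm of `H^{1/2}`: the square root of `‖φ‖²_{L²} + |φ|²_{H^{1/2}}`. -/
def normHHalf (μ : Measure E) (φ : E → 𝕜) : ENNReal :=
  (eLpNorm φ 2 μ ^ 2 + slobodeckijSq μ φ) ^ (1 / 2 : ℝ)

/-- The space `H^{1/2}`: square-integrable functions of finite Sobolev–Slobodeckii semi-norm. -/
def HHalf (μ : Measure E) : Set (E → 𝕜) :=
  {φ | MemLp φ 2 μ ∧ slobodeckijSq μ φ < ⊤}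

/-- The space `H̃^{1/2}(ℝ₊)`: functions of `H^{1/2}(ℝ)` vanishing (almost everywhere)
outside `[0, ∞)`. It carries the norm of `H^{1/2}(ℝ)`. -/
def HHalfTilde (𝕜 : Type*) [RCLike 𝕜] : Set (ℝ → 𝕜) :=
  {φ | φ ∈ HHalf volume ∧ ∀ᵐ x : ℝ, x < 0 → φ x = 0}

/-- The norm of `H^{-1/2}`, the dual of `H^{1/2}`: the supremum of `|⟨v, w⟩| / ‖w‖_{H^{1/2}}`,
where `w = 0` contributes `0 / 0 = 0`. On a curve without end points, such as `ℝ` or an infinite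
cone, the spaces `H̃^{1/2}` and `H^{1/2}` coincide, so that this is the dual of `H̃^{1/2}` too. -/
def normHNegHalf (μ : Measure E) (v : E → 𝕜) : ENNReal :=
  ⨆ w ∈ HHalf (𝕜 := 𝕜) μ, ‖∫ x, v x * w x ∂μ‖ₑ / normHHalf μ w

/-- The norm of `H^{-1/2}(ℝ₊)`, the dual of `H̃^{1/2}(ℝ₊)`. -/
def normHNegHalfRPlus (q : ℝ → 𝕜) : ENNReal :=
  ⨆ w ∈ HHalfTilde 𝕜, ‖∫ t in Ioi (0 : ℝ), q t * w t‖ₑ / normHHalf volume w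

/-- The Riesz potential `⟨A u, v⟩ = ∫∫ u(y) v(x) / √|x - y| dμ(y) dμ(x)`. -/
def rieszForm (μ : Measure E) (u v : E → 𝕜) : 𝕜 :=
  ∫ x, ∫ y, (√‖x - y‖)⁻¹ • (u y * v x) ∂μ ∂μ

/-- The continuity modulus of `χ A χ : L² → H^{1/2}`: the supremum over nonzero `u, v ∈ C^∞_comp` of
`|⟨A (χ u), χ v⟩| / (‖u‖_{L²} ‖v‖_{H^{-1/2}})`, where functions vanishing on the curve contribute
`0 / 0 = 0`. -/
def localizedNorm (𝕜 : Type*) [RCLike 𝕜] (μ : Measure E) (χ : E → ℝ) : ENNReal :=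
  ⨆ u ∈ SmoothComp E 𝕜, ⨆ v ∈ SmoothComp E 𝕜,
    ‖rieszForm μ (fun x => χ x • u x) (fun x => χ x • v x)‖ₑ / (eLpNorm u 2 μ * normHNegHalf μ v)

end Spaces

/-! ### The cone and the corner operators -/

/-- The conic curve with vertex `c` and directions `e₁`, `e₂`: the union of two closed rays. -/
def cone (c e₁ e₂ : Plane) : Set Plane :=
  {x | ∃ t : ℝ, 0 ≤ t ∧ (x = c + t • e₁ ∨ x = c + t • e₂)}

/-- Length measure on the cone: one-dimensional Hausdorff measure restricted to it. -/
def coneMeasure (c e₁ e₂ : Plane) : Measure Plane :=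
  (Measure.hausdorffMeasure 1).restrict (cone c e₁ e₂)

/-- The kernel `K_α(τ) = (4 sin² α + (√τ - 1/√τ)²)^{-1/4}`. -/
def kernelK (α τ : ℝ) : ℝ :=
  (4 * Real.sin α ^ 2 + (√τ - 1 / √τ) ^ 2) ^ (-(1 / 4) : ℝ)

section Operators

variable {𝕜 : Type*} [RCLike 𝕜]

/-- `⟨A_θ⁺ p, q⟩ = ∫∫ (K_0(t/s) + K_θ(t/s)) p(s) q(t) (st)^{-1/4} ds dt`. -/
def Aplus (θ : ℝ) (p q : ℝ → 𝕜) : 𝕜 :=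
  ∫ t in Ioi (0 : ℝ), ∫ s in Ioi (0 : ℝ),
    ((kernelK 0 (t / s) + kernelK θ (t / s)) * (s * t) ^ (-(1 / 4) : ℝ)) • (p s * q t)

/-- `⟨A_θ⁻ p, q⟩ = ∫∫ (K_0(t/s) - K_θ(t/s)) p(s) q(t) (st)^{-1/4} ds dt`. -/
def Aminus (θ : ℝ) (p q : ℝ → 𝕜) : 𝕜 :=
  ∫ t in Ioi (0 : ℝ), ∫ s in Ioi (0 : ℝ),
    ((kernelK 0 (t / s) - kernelK θ (t / s)) * (s * t) ^ (-(1 / 4) : ℝ)) • (p s * q t)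

/-- The supremum over nonzero `p, q ∈ C^∞_0(ℝ₊)` of
`|⟨(A_{π/2}⁺ - A_θ⁺) χ p, χ q⟩| / (‖p‖_{L²(ℝ₊)} ‖q‖_{H^{-1/2}(ℝ₊)})`. -/
def differenceNorm (𝕜 : Type*) [RCLike 𝕜] (θ : ℝ) (χ : ℝ → ℝ) : ENNReal :=
  ⨆ p ∈ SmoothComp₀ 𝕜, ⨆ q ∈ SmoothComp₀ 𝕜,
    ‖Aplus (Real.pi / 2) (fun s => χ s • p s) (fun t => χ t • q t) -
        Aplus θ (fun s => χ s • p s) (fun t => χ t • q t)‖ₑ /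
      (eLpNorm p 2 (volume.restrict (Ioi 0)) * normHNegHalfRPlus q)

end Operators

end

end RieszCorner

namespace RieszCorner

open Filter Topology

/-! ### Bilinear forms with weakly singular kernels, and the corner operators -/

section Forms

variable {𝕜 : Type*} [RCLike 𝕜]

/-! The arc-length parametrization `coneParam` unfolds the cone onto the line. It carries Lebesgue
measure to length measure and is bi-Lipschitz with constants `sin θ` and `1`. Two points on one ray
keep their distance. Points at distances `s`, `t` from the vertex on different rays have squared
distance `(s - t)² + 4 s t sin² θ`, which for `θ = π/2` is the distance on the line. Hence
(`coneKernel_eq`) the kernel of the cone is that of the line plus, on the two quadrants of opposite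
signs, the difference of the quadrant kernels for `θ` and `π/2`. After reflecting one variable, each
such term is minus the form of `A⁺_{π/2} - A⁺_θ`, the `K_0` part cancelling; the same cancellation
gives the first claim.

The norms transfer as well. Length is preserved, so `L²` norms agree, while `H^{-1/2}` norms grow at
most by `1 / sin θ` under unfolding (`normHNegHalf_coneParam_le`). Restriction to a half-line does
not increase the dual norm, because functions of `H̃^{1/2}` are admissible tests on the whole line.

Unfolded smooth functions may have a kink at the vertex and need not vanish there, so they are not
admissible in the suprema. They are cut off near the vertex: the forms converge by dominated
convergence (`tendsto_form_cutoff`), and the error in `H^{-1/2}` is at most the `L²` error, which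
tends to zero. -/

theorem integrableOn_inv_sqrt_abs (R : ℝ) :
    IntegrableOn (fun x : ℝ => (√|x|)⁻¹) (Icc (-R) R) := by
  have h1 : IntegrableOn (fun x : ℝ => (√|x|)⁻¹) (Ioc 0 R) := by
    have := (intervalIntegral.intervalIntegrable_rpow' (r := -(1 / 2)) (a := 0) (b := R)
      (by norm_num)).1
    refine this.congr_fun (fun x hx => ?_) measurableSet_Ioc
    simp only
    rw [abs_of_pos hx.1, Real.sqrt_eq_rpow, Real.rpow_neg hx.1.le]
  have h2 : IntegrableOn (fun x : ℝ => (√|x|)⁻¹) (Ico (-R) 0) := by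
    have := h1.comp_neg
    simpa using this
  have h3 := (h2.union (integrableOn_singleton (x := (0 : ℝ))
    (hx := (measure_singleton (μ := volume) (0 : ℝ)).trans_lt ENNReal.zero_lt_top))).union h1
  refine h3.mono_set fun x hx => ?_
  rcases lt_trichotomy x 0 with h | h | h
  · exact Or.inl (Or.inl ⟨hx.1, h⟩)
  · exact Or.inl (Or.inr h)
  · exact Or.inr ⟨h, hx.2⟩

/-- A kernel with a singularity of order `1/2` on the diagonal. -/
structure WeaklySingular (k : ℝ → ℝ → ℝ) : Prop where
  measurable : Measurable fun p : ℝ × ℝ => k p.1 p.2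
  bound : ∃ C, 0 ≤ C ∧ ∀ x y, x ≠ y → |k x y| ≤ C * (√|x - y|)⁻¹

/-- A function bounded by `M` and vanishing off `[-R, R]`. -/
structure BoundedSupp (R M : ℝ) (u : ℝ → 𝕜) : Prop where
  aesm : AEStronglyMeasurable u volume
  le : ∀ x, ‖u x‖ ≤ M
  supp : ∀ x, R < |x| → u x = 0

/-- The bilinear form with kernel `k`. -/
noncomputable def kernelForm (k : ℝ → ℝ → ℝ) (u v : ℝ → 𝕜) : 𝕜 :=
  ∫ x, ∫ y, k x y • (u y * v x)

/-- An integrable majorant for weakly singular kernels on bounded sets. -/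
noncomputable def majorant (R : ℝ) (p : ℝ × ℝ) : ℝ :=
  (Icc (-R) R).indicator (fun _ => 1) p.2 *
    (Icc (-(2 * R)) (2 * R)).indicator (fun x => (√|x|)⁻¹) (p.1 - p.2)

/-- The majorant is the integrand of a convolution of two integrable functions. -/
theorem integrable_majorant (R : ℝ) :
    Integrable (majorant R) (volume.prod volume) := by
  have hf : Integrable ((Icc (-R) R).indicator (fun _ => (1 : ℝ))) volume :=
    (integrable_indicator_iff measurableSet_Icc).2 (by simp [integrableOn_const_iff])
  have hg : Integrable ((Icc (-(2 * R)) (2 * R)).indicator (fun x : ℝ => (√|x|)⁻¹)) volume :=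
    (integrable_indicator_iff measurableSet_Icc).2 (integrableOn_inv_sqrt_abs (2 * R))
  exact hf.convolution_integrand (ContinuousLinearMap.mul ℝ ℝ) hg

theorem ae_fst_ne_snd : ∀ᵐ p : ℝ × ℝ ∂(volume.prod volume), p.1 ≠ p.2 := by
  have hm : MeasurableSet {p : ℝ × ℝ | p.1 = p.2} :=
    measurableSet_eq_fun measurable_fst measurable_snd
  have : (volume.prod volume) {p : ℝ × ℝ | p.1 = p.2} = 0 := by
    rw [Measure.measure_prod_null hm]
    refine Eventually.of_forall fun x => ?_
    have : Prod.mk x ⁻¹' {p : ℝ × ℝ | p.1 = p.2} = {x} := by ext y; simp [eq_comm]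
    simp [this]
  rw [ae_iff]
  simpa using this

variable {k : ℝ → ℝ → ℝ} {R M : ℝ} {u v : ℝ → 𝕜}

/-- The constant depends on `R` and `M` only, so that one majorant dominates a whole sequence of
cut-off functions. -/
theorem WeaklySingular.exists_le_majorant (hk : WeaklySingular k) (R M : ℝ) :
    ∃ C : ℝ, ∀ u v : ℝ → 𝕜, BoundedSupp R M u → BoundedSupp R M v →
      ∀ p : ℝ × ℝ, p.1 ≠ p.2 → ‖k p.1 p.2 • (u p.2 * v p.1)‖ ≤ C * majorant R p := by
  obtain ⟨C, hC, hb⟩ := hk.bound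
  refine ⟨C * (M * M), fun u v hu hv p hp => ?_⟩
  have hM : 0 ≤ M := (norm_nonneg _).trans (hu.le 0)
  have hm : 0 ≤ majorant R p := by
    refine mul_nonneg (indicator_nonneg (fun _ _ => zero_le_one) _)
      (indicator_nonneg (fun _ _ => by positivity) _)
  by_cases h1 : R < |p.2|
  · rw [hu.supp _ h1]; simp; positivity
  by_cases h2 : R < |p.1|
  · rw [hv.supp _ h2]; simp; positivity
  rw [not_lt, abs_le] at h1 h2
  have e : majorant R p = (√|p.1 - p.2|)⁻¹ := by
    rw [majorant, indicator_of_mem (show p.2 ∈ Icc (-R) R from h1), indicator_of_mem, one_mul]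
    constructor <;> linarith [h1.1, h1.2, h2.1, h2.2]
  rw [e, norm_smul, norm_mul, Real.norm_eq_abs]
  calc |k p.1 p.2| * (‖u p.2‖ * ‖v p.1‖) ≤ (C * (√|p.1 - p.2|)⁻¹) * (M * M) := by
        gcongr
        · exact hb _ _ hp
        · exact hu.le _
        · exact hv.le _
    _ = _ := by ring

theorem WeaklySingular.aesm (hk : WeaklySingular k) (hu : BoundedSupp R M u)
    (hv : BoundedSupp R M v) :
    AEStronglyMeasurable (fun p : ℝ × ℝ => k p.1 p.2 • (u p.2 * v p.1))
      (volume.prod volume) :=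
  hk.measurable.aestronglyMeasurable.smul (hu.aesm.comp_snd.mul hv.aesm.comp_fst)

theorem WeaklySingular.integrable (hk : WeaklySingular k) (hu : BoundedSupp R M u)
    (hv : BoundedSupp R M v) :
    Integrable (fun p : ℝ × ℝ => k p.1 p.2 • (u p.2 * v p.1)) (volume.prod volume) := by
  obtain ⟨C, hC⟩ := hk.exists_le_majorant (𝕜 := 𝕜) R M
  refine ((integrable_majorant R).const_mul C).mono' (hk.aesm hu hv) ?_
  filter_upwards [ae_fst_ne_snd] with p hp using hC u v hu hv p hp

theorem WeaklySingular.kernelForm_eq (hk : WeaklySingular k) (hu : BoundedSupp R M u)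
    (hv : BoundedSupp R M v) :
    kernelForm k u v = ∫ p : ℝ × ℝ, k p.1 p.2 • (u p.2 * v p.1) ∂(volume.prod volume) :=
  (integral_prod _ (hk.integrable hu hv)).symm

/-- Convergence is asked only of the product with the kernel and off the axes: cutoffs need not
converge at the vertex, and the factors are irrelevant where the kernel vanishes. -/
theorem WeaklySingular.tendsto_kernelForm (hk : WeaklySingular k) {us vs : ℕ → ℝ → 𝕜}
    (hu : BoundedSupp R M u) (hv : BoundedSupp R M v)
    (hus : ∀ n, BoundedSupp R M (us n)) (hvs : ∀ n, BoundedSupp R M (vs n))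
    (h : ∀ x y, x ≠ 0 → y ≠ 0 →
      Tendsto (fun n => k x y • (us n y * vs n x)) atTop (𝓝 (k x y • (u y * v x)))) :
    Tendsto (fun n => kernelForm k (us n) (vs n)) atTop (𝓝 (kernelForm k u v)) := by
  obtain ⟨C, hC⟩ := hk.exists_le_majorant (𝕜 := 𝕜) R M
  simp only [fun n => hk.kernelForm_eq (hus n) (hvs n), hk.kernelForm_eq hu hv]
  have h0 : ∀ᵐ x : ℝ ∂volume, x ≠ 0 := by simp [ae_iff]
  refine tendsto_integral_of_dominated_convergence (fun p => C * majorant R p)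
    (fun n => hk.aesm (hus n) (hvs n)) ((integrable_majorant R).const_mul C) (fun n => ?_) ?_
  · filter_upwards [ae_fst_ne_snd] with p hp using hC _ _ (hus n) (hvs n) p hp
  · filter_upwards [Measure.quasiMeasurePreserving_fst.ae h0,
      Measure.quasiMeasurePreserving_snd.ae h0] with p hp hp' using h _ _ hp hp'

theorem WeaklySingular.add {k' : ℝ → ℝ → ℝ} (hk : WeaklySingular k) (hk' : WeaklySingular k') :
    WeaklySingular fun x y => k x y + k' x y := by
  obtain ⟨C, hC, hb⟩ := hk.bound
  obtain ⟨C', hC', hb'⟩ := hk'.bound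
  refine ⟨hk.measurable.add hk'.measurable, C + C', add_nonneg hC hC', fun x y h => ?_⟩
  rw [add_mul]
  exact (abs_add_le _ _).trans (add_le_add (hb x y h) (hb' x y h))

theorem WeaklySingular.sub {k' : ℝ → ℝ → ℝ} (hk : WeaklySingular k) (hk' : WeaklySingular k') :
    WeaklySingular fun x y => k x y - k' x y := by
  obtain ⟨C, hC, hb⟩ := hk.bound
  obtain ⟨C', hC', hb'⟩ := hk'.bound
  refine ⟨hk.measurable.sub hk'.measurable, C + C', add_nonneg hC hC', fun x y h => ?_⟩
  rw [add_mul]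
  exact (abs_sub _ _).trans (add_le_add (hb x y h) (hb' x y h))

theorem kernelForm_add {k' : ℝ → ℝ → ℝ} (hk : WeaklySingular k) (hk' : WeaklySingular k')
    (hu : BoundedSupp R M u) (hv : BoundedSupp R M v) :
    kernelForm (fun x y => k x y + k' x y) u v = kernelForm k u v + kernelForm k' u v := by
  rw [hk.kernelForm_eq hu hv, hk'.kernelForm_eq hu hv, (hk.add hk').kernelForm_eq hu hv,
    ← integral_add (hk.integrable hu hv) (hk'.integrable hu hv)]
  simp only [add_smul]

theorem kernelForm_sub {k' : ℝ → ℝ → ℝ} (hk : WeaklySingular k) (hk' : WeaklySingular k')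
    (hu : BoundedSupp R M u) (hv : BoundedSupp R M v) :
    kernelForm (fun x y => k x y - k' x y) u v = kernelForm k u v - kernelForm k' u v := by
  rw [hk.kernelForm_eq hu hv, hk'.kernelForm_eq hu hv, (hk.sub hk').kernelForm_eq hu hv,
    ← integral_sub (hk.integrable hu hv) (hk'.integrable hu hv)]
  simp only [sub_smul]

theorem kernelForm_comp_neg_right (k : ℝ → ℝ → ℝ) (u v : ℝ → 𝕜) :
    kernelForm (fun x y => k x (-y)) u v = kernelForm k (fun y => u (-y)) v := by
  unfold kernelForm
  congr 1; ext x
  rw [← integral_neg_eq_self]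
  simp

theorem kernelForm_comp_neg_left (k : ℝ → ℝ → ℝ) (u v : ℝ → 𝕜) :
    kernelForm (fun x y => k (-x) y) u v = kernelForm k u (fun x => v (-x)) := by
  unfold kernelForm
  rw [← integral_neg_eq_self]
  simp

/-! ### The kernels on the quadrant -/

/-- The kernel `((x - y)² + 4 x y sin² β)^{-1/4}` on the positive quadrant, extended by zero. -/
noncomputable def quadrantKernel (β x y : ℝ) : ℝ :=
  if 0 < x ∧ 0 < y then ((x - y) ^ 2 + 4 * (x * y) * Real.sin β ^ 2) ^ (-(1 / 4) : ℝ) else 0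

theorem rpow_neg_quarter_sq (z : ℝ) : (z ^ 2) ^ (-(1 / 4) : ℝ) = (√|z|)⁻¹ := by
  rw [← sq_abs, ← Real.rpow_natCast, ← Real.rpow_mul (abs_nonneg z), Real.sqrt_eq_rpow,
    ← Real.rpow_neg (abs_nonneg z)]
  norm_num

theorem quadrantKernel_of_not {β x y : ℝ} (h : ¬(0 < x ∧ 0 < y)) : quadrantKernel β x y = 0 :=
  if_neg h

/-- On the quadrant the term with `sin² β` is nonnegative, so the kernel is at most its value for `β
= 0`. -/
theorem weaklySingular_quadrantKernel (β : ℝ) : WeaklySingular (quadrantKernel β) := by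
  refine ⟨?_, 1, zero_le_one, fun x y h => ?_⟩
  · refine Measurable.ite ?_ (by fun_prop) measurable_const
    exact (measurableSet_lt measurable_const measurable_fst).inter
      (measurableSet_lt measurable_const measurable_snd)
  · rw [quadrantKernel, one_mul]
    split_ifs with hxy
    · have h1 : 0 < (x - y) ^ 2 := by have := sub_ne_zero.2 h; positivity
      have h2 : 0 ≤ 4 * (x * y) * Real.sin β ^ 2 := by have := hxy.1; have := hxy.2; positivity
      rw [abs_of_nonneg (by positivity), ← rpow_neg_quarter_sq]
      exact Real.rpow_le_rpow_of_nonpos h1 (by linarith) (by norm_num)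
    · simp

/-- The base equals `sin² β (x + y)² + (1 - sin² β) (x - y)²`. The bound by `x + y` is what keeps
the kernel weakly singular after one variable is reflected. -/
theorem abs_quadrantKernel_le {β : ℝ} (hβ : Real.sin β ≠ 0) (x y : ℝ) :
    |quadrantKernel β x y| ≤ (√|Real.sin β|)⁻¹ * (√|x + y|)⁻¹ := by
  rw [quadrantKernel]
  split_ifs with hxy
  · obtain ⟨hx, hy⟩ := hxy
    have h0 : 0 < (Real.sin β * (x + y)) ^ 2 := by positivity
    have h1 : (Real.sin β * (x + y)) ^ 2 ≤ (x - y) ^ 2 + 4 * (x * y) * Real.sin β ^ 2 := by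
      nlinarith [mul_nonneg (sub_nonneg.2 (Real.sin_sq_le_one β)) (sq_nonneg (x - y))]
    rw [abs_of_nonneg (Real.rpow_nonneg (h0.le.trans h1) _), ← mul_inv,
      ← Real.sqrt_mul (abs_nonneg _), ← abs_mul, ← rpow_neg_quarter_sq]
    exact Real.rpow_le_rpow_of_nonpos h0 h1 (by norm_num)
  · rw [abs_zero]; positivity

theorem weaklySingular_quadrantKernel_neg_right {β : ℝ} (hβ : Real.sin β ≠ 0) :
    WeaklySingular fun x y => quadrantKernel β x (-y) := by
  refine ⟨(weaklySingular_quadrantKernel β).measurable.comp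
    (measurable_fst.prodMk measurable_snd.neg), _, by positivity, fun x y _ =>
      abs_quadrantKernel_le hβ x (-y)⟩

theorem weaklySingular_quadrantKernel_neg_left {β : ℝ} (hβ : Real.sin β ≠ 0) :
    WeaklySingular fun x y => quadrantKernel β (-x) y := by
  refine ⟨(weaklySingular_quadrantKernel β).measurable.comp
    (measurable_fst.neg.prodMk measurable_snd), (√|Real.sin β|)⁻¹, by positivity, fun x y _ => ?_⟩
  have := abs_quadrantKernel_le hβ (-x) y
  rwa [neg_add_eq_sub, abs_sub_comm] at this

/-- The weight clears the denominators: `s t (√(t/s) - √(s/t))² = (t - s)²`. -/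
theorem kernelK_mul_rpow {β s t : ℝ} (hs : 0 < s) (ht : 0 < t) :
    kernelK β (t / s) * (s * t) ^ (-(1 / 4) : ℝ) = quadrantKernel β t s := by
  rw [kernelK, quadrantKernel, if_pos ⟨ht, hs⟩, ← Real.mul_rpow (by positivity) (by positivity)]
  congr 1
  rw [Real.sqrt_div ht.le]
  have h1 := Real.sqrt_pos.2 hs
  have h2 := Real.sqrt_pos.2 ht
  have e1 := Real.sq_sqrt hs.le
  have e2 := Real.sq_sqrt ht.le
  generalize √s = a at *
  generalize √t = b at *
  subst e1 e2
  field_simp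
  ring

theorem Aplus_eq (θ : ℝ) {p q : ℝ → 𝕜} (hp : BoundedSupp R M p) (hq : BoundedSupp R M q) :
    Aplus θ p q = kernelForm (quadrantKernel 0) p q + kernelForm (quadrantKernel θ) p q := by
  rw [← kernelForm_add (weaklySingular_quadrantKernel 0) (weaklySingular_quadrantKernel θ) hp hq,
    Aplus, kernelForm, ← integral_indicator measurableSet_Ioi]
  congr 1; ext t
  by_cases ht : 0 < t
  · rw [indicator_of_mem (mem_Ioi.2 ht), ← integral_indicator measurableSet_Ioi]
    congr 1; ext s
    by_cases hs : 0 < s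
    · rw [indicator_of_mem (mem_Ioi.2 hs), add_mul, kernelK_mul_rpow hs ht, kernelK_mul_rpow hs ht]
    · rw [indicator_of_notMem (by simpa using hs)]; simp [quadrantKernel, hs]
  · rw [indicator_of_notMem (by simpa using ht)]; simp [quadrantKernel, ht]

theorem Aminus_eq (θ : ℝ) {p q : ℝ → 𝕜} (hp : BoundedSupp R M p) (hq : BoundedSupp R M q) :
    Aminus θ p q = kernelForm (quadrantKernel 0) p q - kernelForm (quadrantKernel θ) p q := by
  rw [← kernelForm_sub (weaklySingular_quadrantKernel 0) (weaklySingular_quadrantKernel θ) hp hq,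
    Aminus, kernelForm, ← integral_indicator measurableSet_Ioi]
  congr 1; ext t
  by_cases ht : 0 < t
  · rw [indicator_of_mem (mem_Ioi.2 ht), ← integral_indicator measurableSet_Ioi]
    congr 1; ext s
    by_cases hs : 0 < s
    · rw [indicator_of_mem (mem_Ioi.2 hs), sub_mul, kernelK_mul_rpow hs ht, kernelK_mul_rpow hs ht]
    · rw [indicator_of_notMem (by simpa using hs)]; simp [quadrantKernel, hs]
  · rw [indicator_of_notMem (by simpa using ht)]; simp [quadrantKernel, ht]

theorem exists_boundedSupp {u : ℝ → 𝕜} (hu : Continuous u) (hc : HasCompactSupport u) :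
    ∃ R M, BoundedSupp R M u := by
  obtain ⟨M, hM⟩ := hc.exists_bound_of_continuous hu
  obtain ⟨R, hR⟩ := hc.isBounded.subset_closedBall 0
  refine ⟨R, M, hu.aestronglyMeasurable, hM, fun x hx => ?_⟩
  by_contra h
  have := hR (subset_tsupport _ h)
  rw [mem_closedBall_zero_iff, Real.norm_eq_abs] at this
  exact absurd this (not_le.2 hx)

theorem BoundedSupp.mono {R' M' : ℝ} (hu : BoundedSupp R M u) (hR : R ≤ R') (hM : M ≤ M') :
    BoundedSupp R' M' u :=
  ⟨hu.aesm, fun x => (hu.le x).trans hM, fun x hx => hu.supp x (hR.trans_lt hx)⟩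

/-- Each form splits into convergent `K_0` and `K_α` parts; the former cancel in both differences
and the latter enter with opposite signs. -/
theorem Aplus_sub_eq_neg_Aminus_sub {p q : ℝ → 𝕜} (hp : p ∈ SmoothComp₀ 𝕜)
    (hq : q ∈ SmoothComp₀ 𝕜) (α β : ℝ) :
    Aplus α p q - Aplus β p q = -(Aminus α p q - Aminus β p q) := by
  obtain ⟨R, M, hp⟩ := exists_boundedSupp hp.1.continuous hp.2.1
  obtain ⟨R', M', hq⟩ := exists_boundedSupp hq.1.continuous hq.2.1
  have hp := hp.mono (le_max_left R R') (le_max_left M M')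
  have hq := hq.mono (le_max_right R R') (le_max_right M M')
  rw [Aplus_eq _ hp hq, Aplus_eq _ hp hq, Aminus_eq _ hp hq, Aminus_eq _ hp hq]
  ring

end Forms

/-! ### Unfolding the cone onto the line -/

section Geometry

/-- The arc-length parametrization of the cone by the real line. -/
noncomputable def coneParam (c e₁ e₂ : Plane) (t : ℝ) : Plane :=
  c + max t 0 • e₁ + max (-t) 0 • e₂

theorem coneParam_of_nonneg (c e₁ e₂ : Plane) {t : ℝ} (ht : 0 ≤ t) :
    coneParam c e₁ e₂ t = c + t • e₁ := by
  simp [coneParam, ht]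

theorem coneParam_of_nonpos (c e₁ e₂ : Plane) {t : ℝ} (ht : t ≤ 0) :
    coneParam c e₁ e₂ t = c + (-t) • e₂ := by
  simp [coneParam, ht]

theorem continuous_coneParam (c e₁ e₂ : Plane) : Continuous (coneParam c e₁ e₂) := by
  unfold coneParam; fun_prop

variable {θ : ℝ} {c e₁ e₂ : Plane}

/-- With `a`, `b` the differences of the positive and of the negative parts, the vector is `a e₁ + b
e₂` and `a - b = x - y`; then `a² + b² + 2 a b cos 2θ = (a - b)² + 4 a b cos² θ`. -/
theorem norm_coneParam_sub_sq (h₁ : ‖e₁‖ = 1) (h₂ : ‖e₂‖ = 1)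
    (h : inner ℝ e₁ e₂ = Real.cos (2 * θ)) (x y : ℝ) :
    ‖coneParam c e₁ e₂ x - coneParam c e₁ e₂ y‖ ^ 2 = (x - y) ^ 2 +
      4 * ((max x 0 - max y 0) * (max (-x) 0 - max (-y) 0)) * (1 - Real.sin θ ^ 2) := by
  have e : coneParam c e₁ e₂ x - coneParam c e₁ e₂ y =
      (max x 0 - max y 0) • e₁ + (max (-x) 0 - max (-y) 0) • e₂ := by
    unfold coneParam; module
  have hx : max x 0 - max (-x) 0 = x := by
    rcases le_total 0 x with h | h <;> simp [h]
  have hy : max y 0 - max (-y) 0 = y := by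
    rcases le_total 0 y with h | h <;> simp [h]
  have hxy : x - y = (max x 0 - max y 0) - (max (-x) 0 - max (-y) 0) := by linarith
  rw [e, norm_add_sq_real, norm_smul, norm_smul, h₁, h₂, inner_smul_left, inner_smul_right, h, hxy,
    Real.cos_two_mul, Real.cos_sq']
  simp only [Real.norm_eq_abs, mul_one, sq_abs, conj_trivial]
  ring

/-- The positive part increases and the negative part decreases. -/
theorem max_sub_mul_nonpos (x y : ℝ) :
    (max x 0 - max y 0) * (max (-x) 0 - max (-y) 0) ≤ 0 := by
  rcases le_total x y with h | h
  · exact mul_nonpos_of_nonpos_of_nonneg (sub_nonpos.2 (max_le_max_right _ h))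
      (sub_nonneg.2 (max_le_max_right _ (neg_le_neg h)))
  · exact mul_nonpos_of_nonneg_of_nonpos (sub_nonneg.2 (max_le_max_right _ h))
      (sub_nonpos.2 (max_le_max_right _ (neg_le_neg h)))

theorem norm_coneParam_sub_le (h₁ : ‖e₁‖ = 1) (h₂ : ‖e₂‖ = 1)
    (h : inner ℝ e₁ e₂ = Real.cos (2 * θ)) (x y : ℝ) :
    ‖coneParam c e₁ e₂ x - coneParam c e₁ e₂ y‖ ≤ |x - y| := by
  refine abs_le_of_sq_le_sq' ?_ (abs_nonneg _) |>.2
  rw [norm_coneParam_sub_sq h₁ h₂ h, sq_abs]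
  nlinarith [mul_nonneg (neg_nonneg.2 (max_sub_mul_nonpos x y))
    (sub_nonneg.2 (Real.sin_sq_le_one θ))]

theorem le_norm_coneParam_sub (h₁ : ‖e₁‖ = 1) (h₂ : ‖e₂‖ = 1)
    (h : inner ℝ e₁ e₂ = Real.cos (2 * θ)) (x y : ℝ) :
    Real.sin θ * |x - y| ≤ ‖coneParam c e₁ e₂ x - coneParam c e₁ e₂ y‖ := by
  refine abs_le_of_sq_le_sq' ?_ (norm_nonneg _) |>.2
  have hx : max x 0 - max (-x) 0 = x := by
    rcases le_total 0 x with h | h <;> simp [h]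
  have hy : max y 0 - max (-y) 0 = y := by
    rcases le_total 0 y with h | h <;> simp [h]
  have hxy : x - y = (max x 0 - max y 0) - (max (-x) 0 - max (-y) 0) := by linarith
  rw [norm_coneParam_sub_sq h₁ h₂ h, mul_pow, sq_abs, hxy]
  -- The difference of the two sides is `cos² θ (a + b)²`, with `a`, `b` the differences of the
  -- positive and negative parts.
  nlinarith [mul_nonneg (sub_nonneg.2 (Real.sin_sq_le_one θ))
    (sq_nonneg ((max x 0 - max y 0) + (max (-x) 0 - max (-y) 0)))]

theorem measurableEmbedding_coneParam (hθ : θ ∈ Ioo 0 Real.pi) (h₁ : ‖e₁‖ = 1) (h₂ : ‖e₂‖ = 1)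
    (h : inner ℝ e₁ e₂ = Real.cos (2 * θ)) : MeasurableEmbedding (coneParam c e₁ e₂) := by
  have hs := Real.sin_pos_of_mem_Ioo hθ
  have hl : LipschitzWith 1 (coneParam c e₁ e₂) := LipschitzWith.of_dist_le_mul fun x y => by
    simpa [dist_eq_norm] using norm_coneParam_sub_le h₁ h₂ h x y
  have ha : AntilipschitzWith (Real.toNNReal (Real.sin θ)⁻¹) (coneParam c e₁ e₂) :=
    AntilipschitzWith.of_le_mul_dist fun x y => by
      rw [Real.coe_toNNReal _ (by positivity), dist_eq_norm, dist_eq_norm, Real.norm_eq_abs,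
        inv_mul_eq_div, le_div_iff₀' hs]
      exact le_norm_coneParam_sub h₁ h₂ h x y
  exact (ha.isClosedEmbedding hl.uniformContinuous).measurableEmbedding

theorem range_coneParam (c e₁ e₂ : Plane) : range (coneParam c e₁ e₂) = cone c e₁ e₂ := by
  ext x
  constructor
  · rintro ⟨t, rfl⟩
    rcases le_total 0 t with ht | ht
    · exact ⟨t, ht, Or.inl (coneParam_of_nonneg _ _ _ ht)⟩
    · exact ⟨-t, neg_nonneg.2 ht, Or.inr (coneParam_of_nonpos _ _ _ ht)⟩
  · rintro ⟨t, ht, rfl | rfl⟩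
    · exact ⟨t, coneParam_of_nonneg _ _ _ ht⟩
    · exact ⟨-t, by rw [coneParam_of_nonpos _ _ _ (neg_nonpos.2 ht), neg_neg]⟩

theorem isometry_ray (c : Plane) {e : Plane} (he : ‖e‖ = 1) : Isometry fun t : ℝ => c + t • e := by
  refine Isometry.of_dist_eq fun x y => ?_
  rw [dist_add_left, dist_eq_norm, ← sub_smul, norm_smul, he, mul_one, dist_eq_norm]

theorem hausdorffMeasure_ray_image (c : Plane) {e : Plane} (he : ‖e‖ = 1) (s : Set ℝ) :
    Measure.hausdorffMeasure 1 ((fun t : ℝ => c + t • e) '' s) = volume s := by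
  rw [(isometry_ray c he).hausdorffMeasure_image (Or.inl zero_le_one), hausdorffMeasure_real]

/-- On each half-line the parametrization is an isometry, which preserves one-dimensional Hausdorff
measure. -/
theorem map_coneParam_volume (hθ : θ ∈ Ioo 0 Real.pi) (h₁ : ‖e₁‖ = 1) (h₂ : ‖e₂‖ = 1)
    (h : inner ℝ e₁ e₂ = Real.cos (2 * θ)) :
    Measure.map (coneParam c e₁ e₂) volume = coneMeasure c e₁ e₂ := by
  have hγ := measurableEmbedding_coneParam (c := c) hθ h₁ h₂ h
  ext A hA
  have hB := hγ.measurable hA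
  set B := coneParam c e₁ e₂ ⁻¹' A with hBdef
  rw [hγ.map_apply, coneMeasure, Measure.restrict_apply hA, ← range_coneParam,
    ← image_preimage_eq_inter_range, ← hBdef, ← inter_union_compl B (Ici 0), image_union,
    measure_union
      ((disjoint_image_iff hγ.injective).2 (disjoint_compl_right.mono inter_subset_right
        inter_subset_right)) (hγ.measurableSet_image.2 (hB.diff measurableSet_Ici)),
    measure_union (disjoint_compl_right.mono inter_subset_right inter_subset_right)
      (hB.diff measurableSet_Ici)]
  congr 1
  · rw [← hausdorffMeasure_ray_image c h₁]
    congr 1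
    exact image_congr fun t ht => (coneParam_of_nonneg _ _ _ ht.2).symm
  · have h₂' : ‖-e₂‖ = 1 := by rw [norm_neg, h₂]
    rw [← hausdorffMeasure_ray_image c h₂']
    congr 1
    refine image_congr fun t ht => ?_
    rw [coneParam_of_nonpos _ _ _ (not_le.1 (notMem_Ici.1 ht.2).not_ge).le, neg_smul, smul_neg]

/-- The kernel of the Riesz potential on the unfolded cone. -/
noncomputable def coneKernel (c e₁ e₂ : Plane) (x y : ℝ) : ℝ :=
  (√‖coneParam c e₁ e₂ x - coneParam c e₁ e₂ y‖)⁻¹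

/-- The kernel of the Riesz potential on the line. -/
noncomputable def lineKernel (x y : ℝ) : ℝ := (√|x - y|)⁻¹

/-- On quadrants of opposite signs the `π/2` kernel is the line kernel, since `(x + y)² - 4 x y = (x
- y)²`, and only the `θ` kernel survives. -/
theorem coneKernel_eq (h₁ : ‖e₁‖ = 1) (h₂ : ‖e₂‖ = 1)
    (h : inner ℝ e₁ e₂ = Real.cos (2 * θ)) (x y : ℝ) :
    coneKernel c e₁ e₂ x y = lineKernel x y +
      (quadrantKernel θ x (-y) - quadrantKernel (Real.pi / 2) x (-y)) +
      (quadrantKernel θ (-x) y - quadrantKernel (Real.pi / 2) (-x) y) := by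
  have e : coneKernel c e₁ e₂ x y = ((x - y) ^ 2 + 4 * ((max x 0 - max y 0) *
      (max (-x) 0 - max (-y) 0)) * (1 - Real.sin θ ^ 2)) ^ (-(1 / 4) : ℝ) := by
    rw [← norm_coneParam_sub_sq (c := c) h₁ h₂ h, rpow_neg_quarter_sq, abs_norm, coneKernel]
  have e' : lineKernel x y = ((x - y) ^ 2) ^ (-(1 / 4) : ℝ) := (rpow_neg_quarter_sq _).symm
  rw [e, e']
  by_cases hxy : 0 < x ∧ 0 < -y
  · have hx' : ¬(0 < -x ∧ 0 < y) := fun h => by linarith [hxy.1, h.1]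
    have a1 : max x 0 = x := max_eq_left hxy.1.le
    have a2 : max (-x) 0 = 0 := max_eq_right (by linarith [hxy.1])
    have a3 : max y 0 = 0 := max_eq_right (by linarith [hxy.2])
    have a4 : max (-y) 0 = -y := max_eq_left hxy.2.le
    rw [quadrantKernel_of_not hx', quadrantKernel_of_not hx', quadrantKernel, quadrantKernel,
      if_pos hxy, if_pos hxy, Real.sin_pi_div_two, a1, a2, a3, a4]
    ring_nf
  · by_cases hyx : 0 < -x ∧ 0 < y
    · have a1 : max x 0 = 0 := max_eq_right (by linarith [hyx.1])
      have a2 : max (-x) 0 = -x := max_eq_left hyx.1.le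
      have a3 : max y 0 = y := max_eq_left hyx.2.le
      have a4 : max (-y) 0 = 0 := max_eq_right (by linarith [hyx.2])
      rw [quadrantKernel_of_not hxy, quadrantKernel_of_not hxy, quadrantKernel, quadrantKernel,
        if_pos hyx, if_pos hyx, Real.sin_pi_div_two, a1, a2, a3, a4]
      ring_nf
    -- Both points lie on a common ray, the vertex belonging to both rays.
    · have : (max x 0 - max y 0) * (max (-x) 0 - max (-y) 0) = 0 := by
        rcases le_total 0 x with hx | hx <;> rcases le_total 0 y with hy | hy
        · simp [hx, hy]
        · rcases hx.eq_or_lt with rfl | hx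
          · simp [hy]
          · have : y = 0 := by by_contra h0; exact hxy ⟨hx, neg_pos.2 (lt_of_le_of_ne hy h0)⟩
            simp [this, hx.le]
        · rcases hy.eq_or_lt with rfl | hy
          · simp [hx]
          · have : x = 0 := by by_contra h0; exact hyx ⟨neg_pos.2 (lt_of_le_of_ne hx h0), hy⟩
            simp [this, hy.le]
        · simp [hx, hy]
      rw [this]
      simp only [quadrantKernel_of_not hxy, quadrantKernel_of_not hyx]
      simp

theorem weaklySingular_lineKernel : WeaklySingular lineKernel :=
  ⟨by unfold lineKernel; fun_prop, 1, zero_le_one, fun x y _ => by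
    rw [lineKernel, one_mul, abs_of_nonneg (by positivity)]⟩

variable {𝕜 : Type*} [RCLike 𝕜]

theorem kernelForm_coneKernel (hθ : θ ∈ Ioo 0 Real.pi) (h₁ : ‖e₁‖ = 1) (h₂ : ‖e₂‖ = 1)
    (h : inner ℝ e₁ e₂ = Real.cos (2 * θ)) {R M : ℝ} {u v : ℝ → 𝕜}
    (hu : BoundedSupp R M u) (hv : BoundedSupp R M v) :
    kernelForm (coneKernel c e₁ e₂) u v = kernelForm lineKernel u v +
      kernelForm (fun x y => quadrantKernel θ x y - quadrantKernel (Real.pi / 2) x y)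
        (fun y => u (-y)) v +
      kernelForm (fun x y => quadrantKernel θ x y - quadrantKernel (Real.pi / 2) x y)
        u (fun x => v (-x)) := by
  have hs : Real.sin θ ≠ 0 := (Real.sin_pos_of_mem_Ioo hθ).ne'
  have hs' : Real.sin (Real.pi / 2) ≠ 0 := by simp
  have k1 := (weaklySingular_quadrantKernel_neg_right hs).sub
    (weaklySingular_quadrantKernel_neg_right hs')
  have k2 := (weaklySingular_quadrantKernel_neg_left hs).sub
    (weaklySingular_quadrantKernel_neg_left hs')
  rw [← kernelForm_comp_neg_right, ← kernelForm_comp_neg_left,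
    ← kernelForm_add weaklySingular_lineKernel k1 hu hv,
    ← kernelForm_add (weaklySingular_lineKernel.add k1) k2 hu hv]
  congr 1
  ext x y
  exact coneKernel_eq h₁ h₂ h x y

theorem rieszForm_coneMeasure (hθ : θ ∈ Ioo 0 Real.pi) (h₁ : ‖e₁‖ = 1) (h₂ : ‖e₂‖ = 1)
    (h : inner ℝ e₁ e₂ = Real.cos (2 * θ)) (u v : Plane → 𝕜) :
    rieszForm (coneMeasure c e₁ e₂) u v =
      kernelForm (coneKernel c e₁ e₂) (u ∘ coneParam c e₁ e₂) (v ∘ coneParam c e₁ e₂) := by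
  have hγ := measurableEmbedding_coneParam (c := c) hθ h₁ h₂ h
  rw [rieszForm, ← map_coneParam_volume hθ h₁ h₂ h, hγ.integral_map]
  simp only [hγ.integral_map, kernelForm, coneKernel, Function.comp]

end Geometry

/-! ### Comparison of the dual norms with `L²` and between the line and the half-line -/

section Norms

variable {E 𝕜 : Type*} [NormedAddCommGroup E] [MeasurableSpace E] [RCLike 𝕜]
  {μ : Measure E}

theorem eLpNorm_le_normHHalf (μ : Measure E) (w : E → 𝕜) : eLpNorm w 2 μ ≤ normHHalf μ w := by
  have h : eLpNorm w 2 μ ^ 2 ≤ eLpNorm w 2 μ ^ 2 + slobodeckijSq μ w := le_self_add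
  have h' := ENNReal.rpow_le_rpow h (show (0 : ℝ) ≤ 1 / 2 by norm_num)
  rwa [← ENNReal.rpow_natCast, ← ENNReal.rpow_mul, show ((2 : ℕ) : ℝ) * (1 / 2) = 1 by norm_num,
    ENNReal.rpow_one, ENNReal.rpow_natCast] at h'

/-- Cauchy–Schwarz; this makes `L²` convergence of the cutoffs sufficient. -/
theorem normHNegHalf_le_eLpNorm {v : E → 𝕜} (hv : AEStronglyMeasurable v μ) :
    normHNegHalf μ v ≤ eLpNorm v 2 μ := by
  refine iSup₂_le fun w hw => ENNReal.div_le_of_le_mul ?_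
  calc ‖∫ x, v x * w x ∂μ‖ₑ ≤ eLpNorm (v • w) 1 μ := by
        rw [eLpNorm_one_eq_lintegral_enorm]; exact enorm_integral_le_lintegral_enorm _
    _ ≤ eLpNorm v 2 μ * eLpNorm w 2 μ :=
        eLpNorm_smul_le_mul_eLpNorm hw.1.aestronglyMeasurable hv
    _ ≤ _ := by gcongr; exact eLpNorm_le_normHHalf μ w

theorem normHNegHalf_le_add_sub {f g : E → 𝕜} (hf : MemLp f 2 μ) (hg : MemLp g 2 μ) :
    normHNegHalf μ g ≤ normHNegHalf μ f + normHNegHalf μ (g - f) := by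
  refine iSup₂_le fun w hw => ?_
  have e : ∫ x, g x * w x ∂μ = (∫ x, f x * w x ∂μ) + ∫ x, (g - f) x * w x ∂μ := by
    refine Eq.trans ?_ (integral_add (hf.integrable_mul hw.1) ((hg.sub hf).integrable_mul hw.1))
    congr 1; ext x; simp only [Pi.sub_apply]; ring
  rw [e]
  refine (ENNReal.div_le_div_right (enorm_add_le _ _) _).trans ?_
  rw [ENNReal.add_div]
  exact add_le_add (le_iSup₂_of_le w hw le_rfl) (le_iSup₂_of_le w hw le_rfl)

/-- The test functions vanish on the negative axis, so the values of `f` there play no role. -/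
theorem normHNegHalfRPlus_le {q f : ℝ → 𝕜} (h : ∀ x, 0 < x → q x = f x) :
    normHNegHalfRPlus q ≤ normHNegHalf volume f := by
  refine iSup₂_le fun w hw => le_iSup₂_of_le w hw.1 ?_
  have e : ∫ t in Ioi (0 : ℝ), q t * w t = ∫ t, f t * w t := by
    rw [← integral_indicator measurableSet_Ioi]
    refine integral_congr_ae ?_
    have h0 : ∀ᵐ x : ℝ ∂volume, x ≠ 0 := by simp [ae_iff]
    filter_upwards [hw.2, h0] with x hx hx0
    rcases lt_or_gt_of_ne hx0 with h' | h'
    · rw [hx h', mul_zero, indicator_of_notMem (by simpa using h'.le)]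
    · rw [indicator_of_mem (mem_Ioi.2 h'), h x h']
  rw [e]

end Norms

/-! ### Transfer of norms between the cone and the line -/

section Cone

variable {𝕜 : Type*} [RCLike 𝕜] {θ : ℝ} {c e₁ e₂ : Plane}

theorem enorm_sub_le_mul_enorm_coneParam_sub (hθ : θ ∈ Ioo 0 Real.pi) (h₁ : ‖e₁‖ = 1)
    (h₂ : ‖e₂‖ = 1) (h : inner ℝ e₁ e₂ = Real.cos (2 * θ)) (x y : ℝ) :
    ‖x - y‖ₑ ≤ ENNReal.ofReal (Real.sin θ)⁻¹ *
      ‖coneParam c e₁ e₂ x - coneParam c e₁ e₂ y‖ₑ := by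
  have hs := Real.sin_pos_of_mem_Ioo hθ
  rw [← ofReal_norm, ← ofReal_norm, ← ENNReal.ofReal_mul (by positivity)]
  refine ENNReal.ofReal_le_ofReal ?_
  rw [inv_mul_eq_div, le_div_iff₀' hs]
  exact le_norm_coneParam_sub h₁ h₂ h x y

theorem slobodeckijSq_coneMeasure_le (hθ : θ ∈ Ioo 0 Real.pi) (h₁ : ‖e₁‖ = 1) (h₂ : ‖e₂‖ = 1)
    (h : inner ℝ e₁ e₂ = Real.cos (2 * θ)) (w : Plane → 𝕜) :
    slobodeckijSq (coneMeasure c e₁ e₂) w ≤ ENNReal.ofReal (Real.sin θ)⁻¹ ^ 2 *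
      slobodeckijSq volume (w ∘ coneParam c e₁ e₂) := by
  have hs := Real.sin_pos_of_mem_Ioo hθ
  have hγ := measurableEmbedding_coneParam (c := c) hθ h₁ h₂ h
  set K := ENNReal.ofReal (Real.sin θ)⁻¹ with hK
  have hK0 : K ^ 2 ≠ 0 := pow_ne_zero _ (ENNReal.ofReal_pos.2 (by positivity)).ne'
  have hKt : K ^ 2 ≠ ⊤ := ENNReal.pow_ne_top ENNReal.ofReal_ne_top
  rw [slobodeckijSq, ← map_coneParam_volume hθ h₁ h₂ h, hγ.lintegral_map]
  simp only [hγ.lintegral_map, slobodeckijSq]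
  rw [← lintegral_const_mul' _ _ hKt]
  refine lintegral_mono fun x => ?_
  rw [← lintegral_const_mul' _ _ hKt]
  refine lintegral_mono fun y => ?_
  simp only [Function.comp_apply]
  rw [← ENNReal.mul_div_mul_left _ _ hK0 hKt, ← mul_div_assoc]
  refine ENNReal.div_le_div_left ?_ _
  rw [← mul_pow]
  gcongr
  exact enorm_sub_le_mul_enorm_coneParam_sub hθ h₁ h₂ h x y

theorem eLpNorm_coneMeasure (hθ : θ ∈ Ioo 0 Real.pi) (h₁ : ‖e₁‖ = 1) (h₂ : ‖e₂‖ = 1)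
    (h : inner ℝ e₁ e₂ = Real.cos (2 * θ)) (w : Plane → 𝕜) :
    eLpNorm w 2 (coneMeasure c e₁ e₂) = eLpNorm (w ∘ coneParam c e₁ e₂) 2 volume := by
  rw [← map_coneParam_volume hθ h₁ h₂ h,
    (measurableEmbedding_coneParam (c := c) hθ h₁ h₂ h).eLpNorm_map_measure]

theorem one_le_ofReal_inv_sin (hθ : θ ∈ Ioo 0 Real.pi) :
    1 ≤ ENNReal.ofReal (Real.sin θ)⁻¹ := by
  rw [← ENNReal.ofReal_one]
  exact ENNReal.ofReal_le_ofReal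
    ((one_le_inv₀ (Real.sin_pos_of_mem_Ioo hθ)).2 (Real.sin_le_one θ))

theorem normHHalf_coneMeasure_le (hθ : θ ∈ Ioo 0 Real.pi) (h₁ : ‖e₁‖ = 1) (h₂ : ‖e₂‖ = 1)
    (h : inner ℝ e₁ e₂ = Real.cos (2 * θ)) (w : Plane → 𝕜) :
    normHHalf (coneMeasure c e₁ e₂) w ≤ ENNReal.ofReal (Real.sin θ)⁻¹ *
      normHHalf volume (w ∘ coneParam c e₁ e₂) := by
  set K := ENNReal.ofReal (Real.sin θ)⁻¹ with hK
  have e : K = (K ^ 2) ^ (1 / 2 : ℝ) := by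
    rw [← ENNReal.rpow_natCast, ← ENNReal.rpow_mul]; norm_num
  rw [normHHalf, normHHalf, e, ← ENNReal.mul_rpow_of_nonneg _ _ (by norm_num)]
  refine ENNReal.rpow_le_rpow ?_ (by norm_num)
  rw [mul_add, ← eLpNorm_coneMeasure hθ h₁ h₂ h]
  refine add_le_add ?_ (slobodeckijSq_coneMeasure_le hθ h₁ h₂ h w)
  exact le_mul_of_one_le_left' (one_le_pow_of_one_le' (one_le_ofReal_inv_sin hθ) 2)

/-- By duality from `normHHalf_coneMeasure_le`: each test function on the line is the pull-back of
one on the cone whose norm is at most `1 / sin θ` times as large. -/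
theorem normHNegHalf_coneParam_le (hθ : θ ∈ Ioo 0 Real.pi) (h₁ : ‖e₁‖ = 1) (h₂ : ‖e₂‖ = 1)
    (h : inner ℝ e₁ e₂ = Real.cos (2 * θ)) (v : Plane → 𝕜) :
    normHNegHalf volume (v ∘ coneParam c e₁ e₂) ≤ ENNReal.ofReal (Real.sin θ)⁻¹ *
      normHNegHalf (coneMeasure c e₁ e₂) v := by
  have hs := Real.sin_pos_of_mem_Ioo hθ
  have hγ := measurableEmbedding_coneParam (c := c) hθ h₁ h₂ h
  have hslob := fun w : Plane → 𝕜 => slobodeckijSq_coneMeasure_le (c := c) hθ h₁ h₂ h w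
  have hnorm := fun w : Plane → 𝕜 => normHHalf_coneMeasure_le (c := c) hθ h₁ h₂ h w
  set K := ENNReal.ofReal (Real.sin θ)⁻¹ with hK
  have hK0 : K ≠ 0 := (ENNReal.ofReal_pos.2 (by positivity)).ne'
  have hKt : K ≠ ⊤ := ENNReal.ofReal_ne_top
  refine iSup₂_le fun w hw => ?_
  -- Transport `w` to the cone and extend by zero to the plane.
  obtain ⟨W, rfl⟩ : ∃ W : Plane → 𝕜, W ∘ coneParam c e₁ e₂ = w :=
    ⟨Function.extend (coneParam c e₁ e₂) w 0, funext fun x => hγ.injective.extend_apply _ _ _⟩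
  have hW : W ∈ HHalf (coneMeasure c e₁ e₂) := by
    refine ⟨?_, (hslob W).trans_lt (ENNReal.mul_lt_top (ENNReal.pow_lt_top hKt.lt_top) hw.2)⟩
    rw [← map_coneParam_volume hθ h₁ h₂ h, hγ.memLp_map_measure_iff]
    exact hw.1
  have e : ∫ x, (v ∘ coneParam c e₁ e₂) x * (W ∘ coneParam c e₁ e₂) x =
      ∫ x, v x * W x ∂(coneMeasure c e₁ e₂) := by
    rw [← map_coneParam_volume hθ h₁ h₂ h, hγ.integral_map]; rfl
  rw [e, ← ENNReal.mul_div_mul_left _ _ hK0 hKt]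
  refine (ENNReal.div_le_div_left (hnorm W) _).trans ?_
  rw [mul_div_assoc]
  gcongr
  exact le_iSup₂_of_le W hW le_rfl

theorem coneMeasure_comm (c e₁ e₂ : Plane) : coneMeasure c e₂ e₁ = coneMeasure c e₁ e₂ := by
  have : cone c e₂ e₁ = cone c e₁ e₂ := by ext x; simp only [cone, mem_ofPred_eq, or_comm]
  rw [coneMeasure, this, coneMeasure]

end Cone

/-! ### Cutting off near the vertex -/

section Approximation

variable {𝕜 : Type*} [RCLike 𝕜]

/-- A smooth cutoff vanishing on `(-∞, 1/(n+1)]` and equal to one on `[2/(n+1), ∞)`. -/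
noncomputable def cutoff (n : ℕ) (x : ℝ) : ℝ := Real.smoothTransition ((n + 1) * x - 1)

theorem contDiff_cutoff (n : ℕ) : ContDiff ℝ ∞ (cutoff n) :=
  Real.smoothTransition.contDiff.comp (by fun_prop)

theorem cutoff_of_le {n : ℕ} {x : ℝ} (h : (n + 1) * x ≤ 1) : cutoff n x = 0 :=
  Real.smoothTransition.zero_of_nonpos (by linarith)

theorem cutoff_of_nonpos {n : ℕ} {x : ℝ} (h : x ≤ 0) : cutoff n x = 0 :=
  cutoff_of_le ((mul_nonpos_of_nonneg_of_nonpos (by positivity) h).trans zero_le_one)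

theorem cutoff_of_ge {n : ℕ} {x : ℝ} (h : 2 ≤ (n + 1) * x) : cutoff n x = 1 :=
  Real.smoothTransition.one_of_one_le (by linarith)

theorem abs_cutoff_le (n : ℕ) (x : ℝ) : |cutoff n x| ≤ 1 := by
  rw [cutoff, abs_of_nonneg (Real.smoothTransition.nonneg _)]
  exact Real.smoothTransition.le_one _

theorem tendsto_cutoff {x : ℝ} (hx : 0 < x) : Tendsto (fun n => cutoff n x) atTop (𝓝 1) := by
  refine tendsto_const_nhds.congr' ?_
  obtain ⟨N, hN⟩ := exists_nat_gt (2 / x)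
  filter_upwards [eventually_ge_atTop N] with n hn
  refine (cutoff_of_ge ?_).symm
  have : (N : ℝ) ≤ n := by exact_mod_cast hn
  rw [div_lt_iff₀ hx] at hN
  nlinarith

/-- The restriction of `u` to a ray, cut off near the vertex. -/
noncomputable def rayCutoff (c e : Plane) (u : Plane → 𝕜) (n : ℕ) (x : ℝ) : 𝕜 :=
  cutoff n x • u (c + x • e)

/-- The pull-back of `u` under the unfolding of the cone, cut off near the vertex. -/
noncomputable def lineCutoff (c e₁ e₂ : Plane) (u : Plane → 𝕜) (n : ℕ) (x : ℝ) : 𝕜 :=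
  rayCutoff c e₁ u n x + rayCutoff c e₂ u n (-x)

theorem hasCompactSupport_comp_ray {F : Type*} [Zero F] {u : Plane → F}
    (hu : HasCompactSupport u) (c : Plane) {e : Plane} (he : ‖e‖ = 1) :
    HasCompactSupport fun x : ℝ => u (c + x • e) :=
  hu.comp_isClosedEmbedding (isometry_ray c he).isClosedEmbedding

variable {u : Plane → 𝕜} {c e e₁ e₂ : Plane}

theorem rayCutoff_mem (hu : u ∈ SmoothComp Plane 𝕜) (he : ‖e‖ = 1) (n : ℕ) :
    rayCutoff c e u n ∈ SmoothComp₀ 𝕜 := by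
  have hray : ContDiff ℝ ∞ fun x : ℝ => c + x • e := by fun_prop
  have hs : HasCompactSupport (cutoff n • fun x : ℝ => u (c + x • e)) :=
    (hasCompactSupport_comp_ray hu.2 c he).smul_left
  refine ⟨(contDiff_cutoff n).smul (hu.1.comp hray), hs, ?_⟩
  have h : tsupport (rayCutoff c e u n) ⊆ Ici (1 / ((n : ℝ) + 1)) := by
    refine closure_minimal (fun x hx => ?_) isClosed_Ici
    by_contra h
    refine hx ?_
    rw [mem_Ici, not_le, lt_div_iff₀' (by positivity)] at h
    simp only [rayCutoff, cutoff_of_le h.le, zero_smul]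
  exact fun x hx => (show (0 : ℝ) < 1 / ((n : ℝ) + 1) by positivity).trans_le (h hx)

/-- The cutoff removes a neighbourhood of the vertex, the only place where smoothness of the
pull-back can fail. -/
theorem lineCutoff_mem (hu : u ∈ SmoothComp Plane 𝕜) (h₁ : ‖e₁‖ = 1) (h₂ : ‖e₂‖ = 1) (n : ℕ) :
    lineCutoff c e₁ e₂ u n ∈ SmoothComp ℝ 𝕜 := by
  obtain ⟨a1, b1, -⟩ := rayCutoff_mem (c := c) hu h₁ n
  obtain ⟨a2, b2, -⟩ := rayCutoff_mem (c := c) hu h₂ n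
  have b3 : HasCompactSupport (rayCutoff c e₂ u n ∘ fun x => -x) :=
    b2.comp_isClosedEmbedding (Homeomorph.neg ℝ).isClosedEmbedding
  exact ⟨a1.add (a2.comp contDiff_neg), b1.add b3⟩

theorem lineCutoff_eq (c e₁ e₂ : Plane) (u : Plane → 𝕜) (n : ℕ) (x : ℝ) :
    lineCutoff c e₁ e₂ u n x = cutoff n |x| • u (coneParam c e₁ e₂ x) := by
  rcases le_total 0 x with hx | hx
  · simp [lineCutoff, rayCutoff, coneParam_of_nonneg _ _ _ hx, abs_of_nonneg hx,
      cutoff_of_nonpos (neg_nonpos.2 hx)]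
  · simp [lineCutoff, rayCutoff, coneParam_of_nonpos _ _ _ hx, abs_of_nonpos hx,
      cutoff_of_nonpos hx]

theorem rayCutoff_eq_lineCutoff (c e₁ e₂ : Plane) (u : Plane → 𝕜) (n : ℕ) {x : ℝ} (hx : 0 < x) :
    rayCutoff c e₁ u n x = lineCutoff c e₁ e₂ u n x := by
  simp [lineCutoff, rayCutoff, cutoff_of_nonpos (neg_nonpos.2 hx.le)]

theorem norm_lineCutoff_le (c e₁ e₂ : Plane) (u : Plane → 𝕜) (n : ℕ) (x : ℝ) :
    ‖lineCutoff c e₁ e₂ u n x‖ ≤ ‖u (coneParam c e₁ e₂ x)‖ := by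
  rw [lineCutoff_eq, norm_smul]
  exact mul_le_of_le_one_left (norm_nonneg _) (abs_cutoff_le n _)

theorem norm_rayCutoff_le (c e : Plane) (u : Plane → 𝕜) (n : ℕ) (x : ℝ) :
    ‖rayCutoff c e u n x‖ ≤ ‖u (c + x • e)‖ := by
  rw [rayCutoff, norm_smul]
  exact mul_le_of_le_one_left (norm_nonneg _) (abs_cutoff_le n _)

theorem tendsto_lineCutoff (c e₁ e₂ : Plane) (u : Plane → 𝕜) {x : ℝ} (hx : x ≠ 0) :
    Tendsto (fun n => lineCutoff c e₁ e₂ u n x) atTop (𝓝 (u (coneParam c e₁ e₂ x))) := by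
  simp only [lineCutoff_eq]
  simpa using (tendsto_cutoff (abs_pos.2 hx)).smul_const (u (coneParam c e₁ e₂ x))

theorem coneParam_neg (c e₁ e₂ : Plane) (x : ℝ) : coneParam c e₁ e₂ (-x) = coneParam c e₂ e₁ x := by
  rw [coneParam, coneParam, neg_neg, add_right_comm]

/-- The error is at most `2 M` and lives on `|x| ≤ 2 / (n + 1)`, an interval of length `4 / (n +
1)`. -/
theorem tendsto_eLpNorm_lineCutoff_sub {M : ℝ} (hu : ∀ x, ‖u x‖ ≤ M) (c e₁ e₂ : Plane) :
    Tendsto (fun n => eLpNorm (lineCutoff c e₁ e₂ u n - u ∘ coneParam c e₁ e₂) 2 volume) atTop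
      (𝓝 0) := by
  have hM : 0 ≤ M := (norm_nonneg _).trans (hu 0)
  have hb : ∀ n : ℕ, eLpNorm (lineCutoff c e₁ e₂ u n - u ∘ coneParam c e₁ e₂) 2 volume ≤
      ‖2 * M‖ₑ * ENNReal.ofReal (4 / ((n : ℝ) + 1)) ^ (1 / 2 : ℝ) := fun n => by
    have h1 : eLpNorm ((Icc (-(2 / ((n : ℝ) + 1))) (2 / ((n : ℝ) + 1))).indicator
        fun _ => 2 * M) 2 volume =
        ‖2 * M‖ₑ * ENNReal.ofReal (4 / ((n : ℝ) + 1)) ^ (1 / 2 : ℝ) := by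
      rw [eLpNorm_indicator_const measurableSet_Icc (by norm_num) (by norm_num), Real.volume_Icc]
      congr 3
      ring
    rw [← h1]
    refine eLpNorm_mono fun x => ?_
    rw [Pi.sub_apply, Function.comp_apply, indicator]
    split_ifs with hx
    · refine (norm_sub_le _ _).trans ?_
      rw [Real.norm_of_nonneg (by positivity)]
      linarith [(norm_lineCutoff_le c e₁ e₂ u n x).trans (hu _), hu (coneParam c e₁ e₂ x)]
    · rw [lineCutoff_eq, cutoff_of_ge, one_smul, sub_self]
      · simp
      · rw [mem_Icc, ← abs_le, not_le, div_lt_iff₀' (by positivity)] at hx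
        exact hx.le
  refine tendsto_of_tendsto_of_tendsto_of_le_of_le tendsto_const_nhds ?_ (fun _ => zero_le) hb
  have h2 : Tendsto (fun n : ℕ => (4 : ℝ) / ((n : ℝ) + 1)) atTop (𝓝 0) := by
    simpa [div_eq_mul_inv] using (tendsto_one_div_add_atTop_nhds_zero_nat (𝕜 := ℝ)).const_mul 4
  have h3 := ((ENNReal.continuous_rpow_const (y := 1 / 2)).tendsto _).comp
    (ENNReal.tendsto_ofReal h2)
  have h4 := ENNReal.Tendsto.const_mul (a := ‖2 * M‖ₑ) h3 (Or.inr enorm_ne_top)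
  simpa [Function.comp_def] using h4

end Approximation

/-! ### The estimate on the cone -/

section Bounds

variable {𝕜 : Type*} [RCLike 𝕜]

theorem BoundedSupp.smul_continuous {R M M' : ℝ} {χ : ℝ → ℝ} {f : ℝ → 𝕜}
    (hχ : BoundedSupp R M χ) (hf : Continuous f) (hb : ∀ x, ‖f x‖ ≤ M') :
    BoundedSupp R (M * M') fun x => χ x • f x := by
  refine ⟨hχ.aesm.smul hf.aestronglyMeasurable, fun x => ?_, fun x hx => ?_⟩
  · rw [norm_smul]
    exact mul_le_mul (hχ.le x) (hb x) (norm_nonneg _) ((norm_nonneg _).trans (hχ.le x))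
  · simp only [hχ.supp x hx, zero_smul]

theorem memLp_two_of_continuous {f : ℝ → 𝕜} (hf : Continuous f) (hc : HasCompactSupport f) :
    MemLp f 2 volume :=
  hf.memLp_of_hasCompactSupport hc

/-- Finiteness of `N` covers `b = 0`: the quotient is then finite only if `a = 0`. -/
theorem le_mul_of_div_le {a b N : ENNReal} (h : a / b ≤ N) (hb : b ≠ ⊤) (hN : N ≠ ⊤) :
    a ≤ N * b :=
  (ENNReal.div_le_iff_le_mul (Or.inr hN) (Or.inl hb)).1 h

theorem enorm_rieszForm_le {χ : ℝ → ℝ} (hN : localizedNorm 𝕜 (volume : Measure ℝ) χ ≠ ⊤)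
    {f g : ℝ → 𝕜} (hf : f ∈ SmoothComp ℝ 𝕜) (hg : g ∈ SmoothComp ℝ 𝕜) :
    ‖rieszForm volume (fun x => χ x • f x) (fun x => χ x • g x)‖ₑ ≤
      localizedNorm 𝕜 (volume : Measure ℝ) χ * (eLpNorm f 2 volume * normHNegHalf volume g) := by
  have hf2 := memLp_two_of_continuous hf.1.continuous hf.2
  have hg2 := memLp_two_of_continuous hg.1.continuous hg.2
  refine le_mul_of_div_le ?_ (ENNReal.mul_ne_top hf2.eLpNorm_ne_top
    ((normHNegHalf_le_eLpNorm hg2.1).trans_lt hg2.eLpNorm_lt_top).ne) hN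
  exact le_iSup₂_of_le f hf (le_iSup₂_of_le g hg le_rfl)

theorem enorm_Aplus_sub_le {θ : ℝ} {χ : ℝ → ℝ} (hN : differenceNorm 𝕜 θ χ ≠ ⊤)
    {p q : ℝ → 𝕜} (hp : p ∈ SmoothComp₀ 𝕜) (hq : q ∈ SmoothComp₀ 𝕜) :
    ‖Aplus (Real.pi / 2) (fun s => χ s • p s) (fun t => χ t • q t) -
        Aplus θ (fun s => χ s • p s) (fun t => χ t • q t)‖ₑ ≤
      differenceNorm 𝕜 θ χ *
        (eLpNorm p 2 (volume.restrict (Ioi 0)) * normHNegHalfRPlus q) := by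
  have hp2 := (memLp_two_of_continuous hp.1.continuous hp.2.1).restrict (Ioi 0)
  have hq2 := memLp_two_of_continuous hq.1.continuous hq.2.1
  refine le_mul_of_div_le ?_ (ENNReal.mul_ne_top hp2.eLpNorm_ne_top
    (((normHNegHalfRPlus_le fun _ _ => rfl).trans
      (normHNegHalf_le_eLpNorm hq2.1)).trans_lt hq2.eLpNorm_lt_top).ne) hN
  exact le_iSup₂_of_le p hp (le_iSup₂_of_le q hq le_rfl)

theorem rieszForm_volume (u v : ℝ → 𝕜) : rieszForm volume u v = kernelForm lineKernel u v := rfl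

/-- The difference of the kernels of the corner operators. -/
noncomputable def cornerKernel (θ x y : ℝ) : ℝ :=
  quadrantKernel θ x y - quadrantKernel (Real.pi / 2) x y

theorem Aplus_sub_eq {θ R M : ℝ} {p q : ℝ → 𝕜} (hp : BoundedSupp R M p)
    (hq : BoundedSupp R M q) :
    Aplus (Real.pi / 2) p q - Aplus θ p q = -kernelForm (cornerKernel θ) p q := by
  have := kernelForm_sub (weaklySingular_quadrantKernel θ)
    (weaklySingular_quadrantKernel (Real.pi / 2)) hp hq
  rw [Aplus_eq _ hp hq, Aplus_eq _ hp hq, show cornerKernel θ = fun x y =>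
    quadrantKernel θ x y - quadrantKernel (Real.pi / 2) x y from rfl, this]
  ring

theorem weaklySingular_cornerKernel (θ : ℝ) : WeaklySingular (cornerKernel θ) :=
  (weaklySingular_quadrantKernel θ).sub (weaklySingular_quadrantKernel (Real.pi / 2))

theorem cornerKernel_of_not {θ x y : ℝ} (h : ¬(0 < x ∧ 0 < y)) : cornerKernel θ x y = 0 := by
  rw [cornerKernel, quadrantKernel_of_not h, quadrantKernel_of_not h, sub_zero]

variable {θ : ℝ} {c e₁ e₂ : Plane}

theorem hasCompactSupport_comp_coneParam {u : Plane → 𝕜} (hu : HasCompactSupport u) (c : Plane)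
    (h₁ : ‖e₁‖ = 1) (h₂ : ‖e₂‖ = 1) : HasCompactSupport (u ∘ coneParam c e₁ e₂) := by
  have a := hasCompactSupport_comp_ray hu c h₁
  have b := (hasCompactSupport_comp_ray hu c h₂).comp_isClosedEmbedding
    (Homeomorph.neg ℝ).isClosedEmbedding
  refine HasCompactSupport.intro (a.isCompact.union b.isCompact) fun x hx => ?_
  rw [mem_union, not_or] at hx
  rcases le_total 0 x with h | h
  · simpa [coneParam_of_nonneg _ _ _ h] using image_eq_zero_of_notMem_tsupport hx.1
  · simpa [coneParam_of_nonpos _ _ _ h] using image_eq_zero_of_notMem_tsupport hx.2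

theorem memLp_comp_coneParam {u : Plane → 𝕜} (hu : u ∈ SmoothComp Plane 𝕜) (c : Plane)
    (h₁ : ‖e₁‖ = 1) (h₂ : ‖e₂‖ = 1) : MemLp (u ∘ coneParam c e₁ e₂) 2 volume :=
  memLp_two_of_continuous (hu.1.continuous.comp (continuous_coneParam c e₁ e₂))
    (hasCompactSupport_comp_coneParam hu.2 c h₁ h₂)

theorem eLpNorm_lineCutoff_le (hθ : θ ∈ Ioo 0 Real.pi) (h₁ : ‖e₁‖ = 1) (h₂ : ‖e₂‖ = 1)
    (h : inner ℝ e₁ e₂ = Real.cos (2 * θ)) (u : Plane → 𝕜) (n : ℕ) :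
    eLpNorm (lineCutoff c e₁ e₂ u n) 2 volume ≤ eLpNorm u 2 (coneMeasure c e₁ e₂) := by
  rw [eLpNorm_coneMeasure hθ h₁ h₂ h]
  exact eLpNorm_mono fun x => norm_lineCutoff_le c e₁ e₂ u n x

theorem eLpNorm_rayCutoff_le (hθ : θ ∈ Ioo 0 Real.pi) (h₁ : ‖e₁‖ = 1) (h₂ : ‖e₂‖ = 1)
    (h : inner ℝ e₁ e₂ = Real.cos (2 * θ)) (u : Plane → 𝕜) (n : ℕ) :
    eLpNorm (rayCutoff c e₁ u n) 2 (volume.restrict (Ioi 0)) ≤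
      eLpNorm u 2 (coneMeasure c e₁ e₂) := by
  refine le_trans (le_of_eq ?_)
    ((eLpNorm_mono_measure _ (Measure.restrict_le_self (s := Ioi 0))).trans
      (eLpNorm_lineCutoff_le hθ h₁ h₂ h u n))
  refine eLpNorm_congr_ae ?_
  filter_upwards [ae_restrict_mem measurableSet_Ioi] with x hx
    using rayCutoff_eq_lineCutoff c e₁ e₂ u n hx

/-- The error made by the cutoff near the vertex. -/
noncomputable def cutoffError (c e₁ e₂ : Plane) (v : Plane → 𝕜) (n : ℕ) : ENNReal :=
  eLpNorm (lineCutoff c e₁ e₂ v n - v ∘ coneParam c e₁ e₂) 2 volume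

theorem normHNegHalf_lineCutoff_le (hθ : θ ∈ Ioo 0 Real.pi) (h₁ : ‖e₁‖ = 1) (h₂ : ‖e₂‖ = 1)
    (h : inner ℝ e₁ e₂ = Real.cos (2 * θ)) {v : Plane → 𝕜} (hv : v ∈ SmoothComp Plane 𝕜)
    (n : ℕ) :
    normHNegHalf volume (lineCutoff c e₁ e₂ v n) ≤
      ENNReal.ofReal (Real.sin θ)⁻¹ * normHNegHalf (coneMeasure c e₁ e₂) v +
        cutoffError c e₁ e₂ v n := by
  have hl := lineCutoff_mem (c := c) hv h₁ h₂ n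
  have hl2 := memLp_two_of_continuous hl.1.continuous hl.2
  have hv2 := memLp_comp_coneParam hv c h₁ h₂
  refine (normHNegHalf_le_add_sub hv2 hl2).trans (add_le_add ?_ ?_)
  · exact normHNegHalf_coneParam_le hθ h₁ h₂ h v
  · exact normHNegHalf_le_eLpNorm (hl2.sub hv2).1

theorem normHNegHalfRPlus_rayCutoff_le (hθ : θ ∈ Ioo 0 Real.pi) (h₁ : ‖e₁‖ = 1) (h₂ : ‖e₂‖ = 1)
    (h : inner ℝ e₁ e₂ = Real.cos (2 * θ)) {v : Plane → 𝕜} (hv : v ∈ SmoothComp Plane 𝕜)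
    (n : ℕ) :
    normHNegHalfRPlus (rayCutoff c e₁ v n) ≤
      ENNReal.ofReal (Real.sin θ)⁻¹ * normHNegHalf (coneMeasure c e₁ e₂) v +
        cutoffError c e₁ e₂ v n :=
  (normHNegHalfRPlus_le fun _ hx => rayCutoff_eq_lineCutoff c e₁ e₂ v n hx).trans
    (normHNegHalf_lineCutoff_le hθ h₁ h₂ h hv n)

theorem exists_bound {u v : Plane → 𝕜} (hu : u ∈ SmoothComp Plane 𝕜)
    (hv : v ∈ SmoothComp Plane 𝕜) : ∃ M, (∀ x, ‖u x‖ ≤ M) ∧ ∀ x, ‖v x‖ ≤ M := by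
  obtain ⟨M, hM⟩ := hu.2.exists_bound_of_continuous hu.1.continuous
  obtain ⟨M', hM'⟩ := hv.2.exists_bound_of_continuous hv.1.continuous
  exact ⟨max M M', fun x => (hM x).trans (le_max_left _ _),
    fun x => (hM' x).trans (le_max_right _ _)⟩

variable {χ : Plane → ℝ} {u v : Plane → 𝕜}

theorem radial_coneParam (h₁ : ‖e₁‖ = 1) (h₂ : ‖e₂‖ = 1)
    (hr : ∀ x y, dist x c = dist y c → χ x = χ y) (x : ℝ) :
    χ (coneParam c e₁ e₂ x) = χ (c + x • e₁) := by
  refine hr _ _ ?_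
  rcases le_total 0 x with h | h
  · rw [coneParam_of_nonneg _ _ _ h]
  · rw [coneParam_of_nonpos _ _ _ h]
    simp [dist_eq_norm, norm_smul, h₁, h₂]

theorem radial_neg (h₁ : ‖e₁‖ = 1) (hr : ∀ x y, dist x c = dist y c → χ x = χ y) (x : ℝ) :
    χ (c + (-x) • e₁) = χ (c + x • e₁) :=
  hr _ _ (by simp [dist_eq_norm, norm_smul, h₁])

/-- The cut-off form on the line minus the two corner terms tends to the form on the cone. -/
theorem tendsto_form_cutoff (hθ : θ ∈ Ioo 0 Real.pi) (h₁ : ‖e₁‖ = 1) (h₂ : ‖e₂‖ = 1)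
    (h : inner ℝ e₁ e₂ = Real.cos (2 * θ)) {R M : ℝ} {X : ℝ → ℝ} (hX : BoundedSupp R M X)
    (even : ∀ x, X (-x) = X x) (hrad : ∀ x, χ (coneParam c e₁ e₂ x) = X x)
    (hu : u ∈ SmoothComp Plane 𝕜) (hv : v ∈ SmoothComp Plane 𝕜) :
    Tendsto (fun n =>
      rieszForm volume (fun x => X x • lineCutoff c e₁ e₂ u n x)
          (fun x => X x • lineCutoff c e₁ e₂ v n x) -
        (Aplus (Real.pi / 2) (fun x => X x • rayCutoff c e₂ u n x)
            (fun x => X x • rayCutoff c e₁ v n x) -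
          Aplus θ (fun x => X x • rayCutoff c e₂ u n x)
            (fun x => X x • rayCutoff c e₁ v n x)) -
        (Aplus (Real.pi / 2) (fun x => X x • rayCutoff c e₁ u n x)
            (fun x => X x • rayCutoff c e₂ v n x) -
          Aplus θ (fun x => X x • rayCutoff c e₁ u n x)
            (fun x => X x • rayCutoff c e₂ v n x))) atTop
      (𝓝 (rieszForm (coneMeasure c e₁ e₂) (fun x => χ x • u x) (fun x => χ x • v x))) := by
  obtain ⟨M', hMu, hMv⟩ := exists_bound hu hv
  have hγc := continuous_coneParam c e₁ e₂
  have bray : ∀ {w : Plane → 𝕜}, w ∈ SmoothComp Plane 𝕜 → (∀ x, ‖w x‖ ≤ M') →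
      ∀ {e : Plane}, ‖e‖ = 1 → ∀ n, BoundedSupp R (M * M') fun x => X x • rayCutoff c e w n x :=
    fun hw hb e he n => hX.smul_continuous (rayCutoff_mem hw he n).1.continuous
      fun x => (norm_rayCutoff_le _ _ _ _ _).trans (hb _)
  have bline : ∀ {w : Plane → 𝕜}, w ∈ SmoothComp Plane 𝕜 → (∀ x, ‖w x‖ ≤ M') →
      ∀ n, BoundedSupp R (M * M') fun x => X x • lineCutoff c e₁ e₂ w n x :=
    fun hw hb n => hX.smul_continuous (lineCutoff_mem hw h₁ h₂ n).1.continuous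
      fun x => (norm_lineCutoff_le _ _ _ _ _ _).trans (hb _)
  have bcone : ∀ {w : Plane → 𝕜}, w ∈ SmoothComp Plane 𝕜 → (∀ x, ‖w x‖ ≤ M') →
      BoundedSupp R (M * M') fun x => X x • w (coneParam c e₁ e₂ x) :=
    fun hw hb => hX.smul_continuous (hw.1.continuous.comp hγc) fun x => hb _
  have bneg : ∀ {w : Plane → 𝕜}, w ∈ SmoothComp Plane 𝕜 → (∀ x, ‖w x‖ ≤ M') →
      BoundedSupp R (M * M') fun x => X x • w (coneParam c e₁ e₂ (-x)) :=
    fun hw hb => hX.smul_continuous (hw.1.continuous.comp (hγc.comp continuous_neg)) fun x => hb _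
  have tray1 : ∀ (w : Plane → 𝕜) {x : ℝ}, 0 < x → Tendsto (fun n => X x • rayCutoff c e₁ w n x)
      atTop (𝓝 (X x • w (coneParam c e₁ e₂ x))) := fun w x hx => by
    simp only [rayCutoff_eq_lineCutoff c e₁ e₂ w _ hx]
    exact (tendsto_lineCutoff c e₁ e₂ w hx.ne').const_smul _
  have tray2 : ∀ (w : Plane → 𝕜) {x : ℝ}, 0 < x → Tendsto (fun n => X x • rayCutoff c e₂ w n x)
      atTop (𝓝 (X x • w (coneParam c e₁ e₂ (-x)))) := fun w x hx => by
    simp only [rayCutoff_eq_lineCutoff c e₂ e₁ w _ hx, coneParam_neg]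
    exact (tendsto_lineCutoff c e₂ e₁ w hx.ne').const_smul _
  have e : rieszForm (coneMeasure c e₁ e₂) (fun x => χ x • u x) (fun x => χ x • v x) =
      kernelForm lineKernel (fun x => X x • u (coneParam c e₁ e₂ x))
        (fun x => X x • v (coneParam c e₁ e₂ x)) +
      kernelForm (cornerKernel θ) (fun x => X x • u (coneParam c e₁ e₂ (-x)))
        (fun x => X x • v (coneParam c e₁ e₂ x)) +
      kernelForm (cornerKernel θ) (fun x => X x • u (coneParam c e₁ e₂ x))
        (fun x => X x • v (coneParam c e₁ e₂ (-x))) := by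
    rw [rieszForm_coneMeasure hθ h₁ h₂ h]
    have e1 : ∀ w : Plane → 𝕜, (fun x => χ x • w x) ∘ coneParam c e₁ e₂ =
        fun x => X x • w (coneParam c e₁ e₂ x) := fun w => funext fun x => by
      simp only [Function.comp_apply, hrad]
    rw [e1, e1, kernelForm_coneKernel hθ h₁ h₂ h (bcone hu hMu) (bcone hv hMv)]
    -- Radial symmetry enters here: reflecting a product with `X` leaves the factor `X` unchanged.
    simp only [even]
    rfl
  rw [e]
  simp only [fun n => Aplus_sub_eq (θ := θ) (bray hu hMu h₂ n) (bray hv hMv h₁ n),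
    fun n => Aplus_sub_eq (θ := θ) (bray hu hMu h₁ n) (bray hv hMv h₂ n),
    sub_neg_eq_add, rieszForm_volume]
  refine Tendsto.add (Tendsto.add ?_ ?_) ?_
  · refine weaklySingular_lineKernel.tendsto_kernelForm (bcone hu hMu) (bcone hv hMv)
      (bline hu hMu) (bline hv hMv) fun x y hx hy => ?_
    exact (((tendsto_lineCutoff c e₁ e₂ u hy).const_smul _).mul
      ((tendsto_lineCutoff c e₁ e₂ v hx).const_smul _)).const_smul _
  · refine (weaklySingular_cornerKernel θ).tendsto_kernelForm (bneg hu hMu) (bcone hv hMv)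
      (bray hu hMu h₂) (bray hv hMv h₁) fun x y _ _ => ?_
    by_cases hxy : 0 < x ∧ 0 < y
    · exact ((tray2 u hxy.2).mul (tray1 v hxy.1)).const_smul _
    · simp only [cornerKernel_of_not hxy, zero_smul]; exact tendsto_const_nhds
  · refine (weaklySingular_cornerKernel θ).tendsto_kernelForm (bcone hu hMu) (bneg hv hMv)
      (bray hu hMu h₁) (bray hv hMv h₂) fun x y _ _ => ?_
    by_cases hxy : 0 < x ∧ 0 < y
    · exact ((tray1 u hxy.2).mul (tray2 v hxy.1)).const_smul _
    · simp only [cornerKernel_of_not hxy, zero_smul]; exact tendsto_const_nhds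

/-- Each cut-off term is bounded by the line or the corner modulus before passing to the limit. The
factor `2` counts the two orderings of the rays. -/
theorem enorm_rieszForm_coneMeasure_le (hθ : θ ∈ Ioo 0 Real.pi) (h₁ : ‖e₁‖ = 1)
    (h₂ : ‖e₂‖ = 1) (h : inner ℝ e₁ e₂ = Real.cos (2 * θ)) (hχ : ContDiff ℝ ∞ χ)
    (hχc : HasCompactSupport χ) (hr : ∀ x y, dist x c = dist y c → χ x = χ y)
    (hu : u ∈ SmoothComp Plane 𝕜) (hv : v ∈ SmoothComp Plane 𝕜)
    (hN : localizedNorm 𝕜 (volume : Measure ℝ) (fun t => χ (c + t • e₁)) ≠ ⊤)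
    (hD : differenceNorm 𝕜 θ (fun t => χ (c + t • e₁)) ≠ ⊤) :
    ‖rieszForm (coneMeasure c e₁ e₂) (fun x => χ x • u x) (fun x => χ x • v x)‖ₑ ≤
      (localizedNorm 𝕜 (volume : Measure ℝ) (fun t => χ (c + t • e₁)) +
        2 * differenceNorm 𝕜 θ (fun t => χ (c + t • e₁))) *
      (eLpNorm u 2 (coneMeasure c e₁ e₂) * (ENNReal.ofReal (Real.sin θ)⁻¹ *
        normHNegHalf (coneMeasure c e₁ e₂) v)) := by
  -- Exchanging the rays yields the estimates on the second ray from those on the first.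
  have h' : inner ℝ e₂ e₁ = Real.cos (2 * θ) := by rw [real_inner_comm, h]
  obtain ⟨M, -, hMv⟩ := exists_bound hu hv
  have hcX : Continuous fun x : ℝ => χ (c + x • e₁) := by
    have := hχ.continuous; fun_prop
  obtain ⟨_, _, hX⟩ := exists_boundedSupp hcX (hasCompactSupport_comp_ray hχc c h₁)
  set N := localizedNorm 𝕜 (volume : Measure ℝ) (fun t => χ (c + t • e₁))
  set D := differenceNorm 𝕜 θ (fun t => χ (c + t • e₁))
  set L := eLpNorm u 2 (coneMeasure c e₁ e₂) with hL
  set H := ENNReal.ofReal (Real.sin θ)⁻¹ * normHNegHalf (coneMeasure c e₁ e₂) v with hH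
  have hLt : L ≠ ⊤ := by
    rw [hL, eLpNorm_coneMeasure hθ h₁ h₂ h]
    exact (memLp_comp_coneParam hu c h₁ h₂).eLpNorm_ne_top
  have hRay₁ := fun n => normHNegHalfRPlus_rayCutoff_le (c := c) hθ h₁ h₂ h hv n
  have hRay₂ := fun n => normHNegHalfRPlus_rayCutoff_le (c := c) hθ h₂ h₁ h' hv n
  have hLine := fun n => normHNegHalf_lineCutoff_le (c := c) hθ h₁ h₂ h hv n
  have hL₁ := fun n => eLpNorm_rayCutoff_le (c := c) hθ h₁ h₂ h u n
  have hL₂ := fun n => eLpNorm_rayCutoff_le (c := c) hθ h₂ h₁ h' u n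
  rw [coneMeasure_comm] at hL₂
  simp only [coneMeasure_comm c e₁ e₂] at hRay₂
  have t₁ : Tendsto (cutoffError c e₁ e₂ v) atTop (𝓝 0) :=
    tendsto_eLpNorm_lineCutoff_sub hMv c e₁ e₂
  have t₂ : Tendsto (cutoffError c e₂ e₁ v) atTop (𝓝 0) :=
    tendsto_eLpNorm_lineCutoff_sub hMv c e₂ e₁
  have key : ∀ {ε : ℕ → ENNReal} {B : ENNReal}, B ≠ ⊤ → Tendsto ε atTop (𝓝 0) →
      Tendsto (fun n => B * (L * (H + ε n))) atTop (𝓝 (B * (L * H))) := fun hB hε => by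
    have := ENNReal.Tendsto.const_mul (a := L) (tendsto_const_nhds (x := H).add hε)
      (Or.inr hLt)
    rw [add_zero] at this
    exact ENNReal.Tendsto.const_mul this (Or.inr hB)
  have lim := ((key hN t₁).add (key hD t₁)).add (key hD t₂)
  rw [show (N + 2 * D) * (L * H) = N * (L * H) + D * (L * H) + D * (L * H) by ring]
  refine le_of_tendsto_of_tendsto' (tendsto_form_cutoff hθ h₁ h₂ h hX (radial_neg h₁ hr)
    (radial_coneParam h₁ h₂ hr) hu hv).enorm lim fun n => ?_
  refine enorm_sub_le.trans (add_le_add (enorm_sub_le.trans (add_le_add ?_ ?_)) ?_)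
  · refine (enorm_rieszForm_le hN (lineCutoff_mem hu h₁ h₂ n) (lineCutoff_mem hv h₁ h₂ n)).trans ?_
    gcongr
    · exact eLpNorm_lineCutoff_le hθ h₁ h₂ h u n
    · exact hLine n
  · refine (enorm_Aplus_sub_le hD (rayCutoff_mem hu h₂ n) (rayCutoff_mem hv h₁ n)).trans ?_
    gcongr
    · exact hL₂ n
    · exact hRay₁ n
  · refine (enorm_Aplus_sub_le hD (rayCutoff_mem hu h₁ n) (rayCutoff_mem hv h₂ n)).trans ?_
    gcongr
    · exact hL₁ n
    · exact hRay₂ n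

theorem localizedNorm_coneMeasure_le (hθ : θ ∈ Ioo 0 Real.pi) (h₁ : ‖e₁‖ = 1)
    (h₂ : ‖e₂‖ = 1) (h : inner ℝ e₁ e₂ = Real.cos (2 * θ)) (hχ : ContDiff ℝ ∞ χ)
    (hχc : HasCompactSupport χ) (hr : ∀ x y, dist x c = dist y c → χ x = χ y) :
    ENNReal.ofReal (Real.sin θ / 2) * localizedNorm 𝕜 (coneMeasure c e₁ e₂) χ ≤
      localizedNorm 𝕜 (volume : Measure ℝ) (fun t => χ (c + t • e₁)) +
        differenceNorm 𝕜 θ (fun t => χ (c + t • e₁)) := by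
  have hs := Real.sin_pos_of_mem_Ioo hθ
  -- If a modulus on the right is infinite there is nothing to prove; otherwise both can be used as
  -- factors.
  by_cases hN : localizedNorm 𝕜 (volume : Measure ℝ) (fun t => χ (c + t • e₁)) = ⊤
  · simp [hN]
  by_cases hD : differenceNorm 𝕜 θ (fun t => χ (c + t • e₁)) = ⊤
  · simp [hD]
  have main : localizedNorm 𝕜 (coneMeasure c e₁ e₂) χ ≤
      (localizedNorm 𝕜 (volume : Measure ℝ) (fun t => χ (c + t • e₁)) +
        2 * differenceNorm 𝕜 θ (fun t => χ (c + t • e₁))) * ENNReal.ofReal (Real.sin θ)⁻¹ := by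
    refine iSup₂_le fun u hu => iSup₂_le fun v hv => ENNReal.div_le_of_le_mul ?_
    refine (enorm_rieszForm_coneMeasure_le hθ h₁ h₂ h hχ hχc hr hu hv hN hD).trans (le_of_eq ?_)
    ring
  set N := localizedNorm 𝕜 (volume : Measure ℝ) (fun t => χ (c + t • e₁))
  set D := differenceNorm 𝕜 θ (fun t => χ (c + t • e₁))
  -- The constant `sin θ / 2` compensates the dual norm factor `1 / sin θ` and the `2` from `N + 2 D
  -- ≤ 2 (N + D)`.
  have e : ENNReal.ofReal (Real.sin θ / 2) * ENNReal.ofReal (Real.sin θ)⁻¹ * 2 = 1 := by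
    rw [← ENNReal.ofReal_ofNat 2, ← ENNReal.ofReal_mul (by positivity),
      ← ENNReal.ofReal_mul (by positivity), ← ENNReal.ofReal_one]
    congr 1
    field_simp
  calc _ ≤ ENNReal.ofReal (Real.sin θ / 2) * ((2 * N + 2 * D) * ENNReal.ofReal (Real.sin θ)⁻¹) := by
        refine mul_le_mul_right (main.trans ?_) _
        gcongr
        exact le_mul_of_one_le_left' one_le_two
    _ = (ENNReal.ofReal (Real.sin θ / 2) * ENNReal.ofReal (Real.sin θ)⁻¹ * 2) * (N + D) := by ring
    _ = N + D := by rw [e, one_mul]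

end Bounds

end RieszCorner

theorem mainTheorem3 (𝕜 : Type*) [RCLike 𝕜] (θ : ℝ) (hθ : θ ∈ Set.Ioo 0 Real.pi) :
    (∀ p ∈ RieszCorner.SmoothComp₀ 𝕜, ∀ q ∈ RieszCorner.SmoothComp₀ 𝕜,
      RieszCorner.Aplus (Real.pi / 2) p q - RieszCorner.Aplus θ p q =
        -(RieszCorner.Aminus (Real.pi / 2) p q - RieszCorner.Aminus θ p q)) ∧
    ∃ C : ℝ, 0 < C ∧
      ∀ c e₁ e₂ : RieszCorner.Plane, ‖e₁‖ = 1 → ‖e₂‖ = 1 → inner ℝ e₁ e₂ = Real.cos (2 * θ) →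
      ∀ χ : RieszCorner.Plane → ℝ, ContDiff ℝ ∞ χ → HasCompactSupport χ →
        (∀ x y, dist x c = dist y c → χ x = χ y) →
        ENNReal.ofReal C *
            RieszCorner.localizedNorm 𝕜 (RieszCorner.coneMeasure c e₁ e₂) χ ≤
          RieszCorner.localizedNorm 𝕜 (volume : Measure ℝ) (fun t => χ (c + t • e₁)) +
            RieszCorner.differenceNorm 𝕜 θ (fun t => χ (c + t • e₁)) := by
  refine ⟨fun p hp q hq => RieszCorner.Aplus_sub_eq_neg_Aminus_sub hp hq _ _,
    Real.sin θ / 2, half_pos (Real.sin_pos_of_mem_Ioo hθ), ?_⟩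
  intro c e₁ e₂ h₁ h₂ h χ hχ hχc hr
  exact RieszCorner.localizedNorm_coneMeasure_le hθ h₁ h₂ h hχ hχc hr
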